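/- **Weighted Poincaré inequality with power weights.** Let $\Omega\subset\mathbb R^n$ be open and connected with smooth boundary, and suppose that for some $R_0\ge 1$, $B(0,R_0)$ being the open ball, $$\Omega\setminus B(0,R_0)=\{\lambda p : p\in\Omega,\ |p|=R_0,\ \lambda\ge 1\}.$$ Let $x:\overline\Omega\to[0,\infty)$ be a smooth defining function for $\partial\Omega$ (that is, $x>0$ on $\Omega$, and $x=0$, $dx\neq0$ on $\partial\Omega$) such that $x(\lambda p)=\lambda x(p)$ for all $\lambda\ge1$ and $p,\lambda p\in\Omega\setminus B(0,R_0)$. Let $r$ be a smooth positive function on $\overline\Omega$, bounded away from zero, with $r(p)=|p|$ on $\Omega\setminus B(0,R_0)$. Let $g$ be a Riemannian metric, continuous and positive definite on $\overline\Omega$ and of class $C^1$ on $\Omega$, whose components in the coordinates of $\mathbb R^n$ satisfy $g_{ij}(p)\to\delta_{ij}$ as $|p|\to\infty$ in $\Omega$ (no decay rate, and no decay of derivatives, is assumed). Let $\sigma,\mu\in\mathbb R$ satisfy $$\sigma\neq-\tfrac12,\qquad \sigma+\mu+\tfrac n2\neq0 .$$ Then there exist constants $x_0>0$, $C>0$ and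 $R>R_0$, with $\{p\in\Omega: r(p)=R\}=\{p\in\Omega:|p|=R\}$, such that for all $C^2$ tensor fields $u$ (of any type) compactly supported in $\Omega$, $$\int_\Omega x^{2\sigma}r^{2\mu}|u|^2\,d\mu_g\le C\left(\int_{\{x\ge x_0,\ r=R\}}|u|^2\,dS_g+\int_{\{x\ge x_0,\ r\le R\}}|u|^2\,d\mu_g+\int_\Omega x^{2\sigma+2}r^{2\mu}|\nabla u|^2\,d\mu_g\right).$$ Here the sets $\{\cdots\}$ are subsets of $\Omega$, the norms $|\cdot|$ of tensors and the Levi-Civita covariant derivative $\nabla$ are those of $g$, $d\mu_g$ is the Riemannian measure of $g$, and $dS_g$ is the hypersurface measure induced by $g$. -/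

import Mathlib

open MeasureTheory Set Filter Topology
open scoped ContDiff

noncomputable section

namespace WeightedPoincare

/-- Euclidean space `ℝⁿ` with its Euclidean norm. -/
abbrev Euc (n : ℕ) : Type := EuclideanSpace ℝ (Fin n)

/-- The boundary of `Ω` is smooth: near each of its points, `Ω` is one side `{f > 0}` of
a smooth hypersurface `{f = 0}` with `df ≠ 0`. -/
def HasSmoothBoundary {n : ℕ} (Ω : Set (Euc n)) : Prop :=
  ∀ p ∈ frontier Ω, ∃ (U : Set (Euc n)) (f : Euc n → ℝ),
    IsOpen U ∧ p ∈ U ∧ ContDiffOn ℝ ∞ f U ∧ (∀ q ∈ U, fderiv ℝ f q ≠ 0) ∧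
      Ω ∩ U = {q ∈ U | 0 < f q}

/-- A domain (open and connected) with smooth boundary in `ℝⁿ`, which is invariant under scaling
outside the open ball of radius `R₀ ≥ 1`. -/
structure IsScaleInvariantDomain {n : ℕ} (Ω : Set (Euc n)) (R₀ : ℝ) : Prop where
  isOpen : IsOpen Ω
  isConnected : IsConnected Ω
  smoothBoundary : HasSmoothBoundary Ω
  one_le : 1 ≤ R₀
  scaling : Ω \ Metric.ball 0 R₀ =
    {q | ∃ p ∈ Ω ∩ Metric.sphere 0 R₀, ∃ t : ℝ, 1 ≤ t ∧ q = t • p}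

/-- A smooth defining function `x` of `∂Ω` on the closure of `Ω` (positive on `Ω`; zero with
nonzero differential on `∂Ω`), homogeneous of degree one outside the ball of radius `R₀`. -/
structure IsScalingDefiningFunction {n : ℕ} (Ω : Set (Euc n)) (R₀ : ℝ) (x : Euc n → ℝ) :
    Prop where
  smooth : ContDiffOn ℝ ∞ x (closure Ω)
  pos : ∀ p ∈ Ω, 0 < x p
  zero : ∀ p ∈ frontier Ω, x p = 0
  deriv_ne_zero : ∀ p ∈ frontier Ω, fderivWithin ℝ x (closure Ω) p ≠ 0
  homogeneous : ∀ p : Euc n, ∀ t : ℝ, 1 ≤ t → p ∈ Ω \ Metric.ball 0 R₀ →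
    t • p ∈ Ω \ Metric.ball 0 R₀ → x (t • p) = t * x p

/-- A smooth function `r` on the closure of `Ω`, bounded away from zero, which coincides with the
coordinate radius on `Ω` outside the ball of radius `R₀`. -/
structure IsRadialFunction {n : ℕ} (Ω : Set (Euc n)) (R₀ : ℝ) (r : Euc n → ℝ) : Prop where
  smooth : ContDiffOn ℝ ∞ r (closure Ω)
  bounded_below : ∃ δ : ℝ, 0 < δ ∧ ∀ p ∈ Ω, δ ≤ r p
  eq_norm : ∀ p ∈ Ω \ Metric.ball 0 R₀, r p = ‖p‖

/-- A Riemannian metric on `Ω`, given by its matrix `g p = (g_{ij}(p))`: continuous and positive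
definite on the closure of `Ω`, of class `C¹` on `Ω`, and approaching the Euclidean metric as one
recedes to infinity in `Ω`. No decay rate and no decay of derivatives is required. -/
structure IsAsymptoticallyEuclideanMetric {n : ℕ} (Ω : Set (Euc n))
    (g : Euc n → Matrix (Fin n) (Fin n) ℝ) : Prop where
  posDef : ∀ p ∈ closure Ω, (g p).PosDef
  continuousOn : ∀ i j, ContinuousOn (fun p => g p i j) (closure Ω)
  contDiffOn : ∀ i j, ContDiffOn ℝ 1 (fun p => g p i j) Ω
  tendsto : ∀ i j, Tendsto (fun p => g p i j) (Bornology.cobounded (Euc n) ⊓ 𝓟 Ω)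
    (𝓝 ((1 : Matrix (Fin n) (Fin n) ℝ) i j))

/-- Components `T^{i₁…i_k}_{j₁…j_l}` of a tensor with `k` upper and `l` lower indices. -/
abbrev TensorComp (n k l : ℕ) : Type := (Fin k → Fin n) → (Fin l → Fin n) → ℝ

/-- The partial derivative `∂_a f (p)`. -/
def partialD {n : ℕ} (f : Euc n → ℝ) (a : Fin n) (p : Euc n) : ℝ :=
  fderiv ℝ f p (EuclideanSpace.single a 1)

/-- The Christoffel symbol `Γ^m_{ab} = ½ g^{mc} (∂_a g_{cb} + ∂_b g_{ca} - ∂_c g_{ab})`. -/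
def christoffel {n : ℕ} (g : Euc n → Matrix (Fin n) (Fin n) ℝ) (p : Euc n)
    (m a b : Fin n) : ℝ :=
  (1 / 2) * ∑ c, (g p)⁻¹ m c *
    (partialD (fun q => g q c b) a p + partialD (fun q => g q c a) b p
      - partialD (fun q => g q a b) c p)

/-- The Levi-Civita covariant derivative `∇u` of a tensor field `u` with `k` upper and `l` lower
indices. The first lower index of `∇u` is the direction `a` of differentiation:
`∇_a u^I_J = ∂_a u^I_J + ∑ₛ Γ^{iₛ}_{am} u^{…m…}_J - ∑ₜ Γ^m_{a jₜ} u^I_{…m…}`. -/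
def covDeriv {n k l : ℕ} (g : Euc n → Matrix (Fin n) (Fin n) ℝ)
    (u : Euc n → TensorComp n k l) (p : Euc n) : TensorComp n k (l + 1) :=
  fun I aJ =>
    let a : Fin n := aJ 0
    let J : Fin l → Fin n := Fin.tail aJ
    partialD (fun q => u q I J) a p
      + ∑ s : Fin k, ∑ m : Fin n, christoffel g p (I s) a m * u p (Function.update I s m) J
      - ∑ t : Fin l, ∑ m : Fin n, christoffel g p m a (J t) * u p I (Function.update J t m)

/-- The squared norm `|T|²` of a tensor with respect to the inner product with matrix `G`: upper
indices are contracted with `G`, lower ones with its inverse. -/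
def normSq {n k l : ℕ} (G : Matrix (Fin n) (Fin n) ℝ) (T : TensorComp n k l) : ℝ :=
  ∑ I : Fin k → Fin n, ∑ I' : Fin k → Fin n, ∑ J : Fin l → Fin n, ∑ J' : Fin l → Fin n,
    (∏ s, G (I s) (I' s)) * (∏ t, G⁻¹ (J t) (J' t)) * T I J * T I' J'

/-- The integral of `f` over `A` with respect to the Riemannian measure `√(det g) dy`. -/
def volInt {n : ℕ} (g : Euc n → Matrix (Fin n) (Fin n) ℝ) (A : Set (Euc n))
    (f : Euc n → ℝ) : ℝ :=
  ∫ p in A, f p * √((g p).det)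

/-- The integral of `f` over the part in `A` of the sphere of radius `R` about the origin, with
respect to the hypersurface measure induced by `g`. That measure has the density
`√(det g · g^{ij} ν_i ν_j)`, `ν` being the Euclidean unit conormal, with respect to the Euclidean
surface measure, which is `R ^ (n - 1)` times the surface measure of the unit sphere. -/
def sphereInt {n : ℕ} (g : Euc n → Matrix (Fin n) (Fin n) ℝ) (R : ℝ) (A : Set (Euc n))
    (f : Euc n → ℝ) : ℝ :=
  R ^ (n - 1) * ∫ ν : Metric.sphere (0 : Euc n) 1,
    A.indicator (fun p => f p *
      √((g p).det * ∑ i, ∑ j, (g p)⁻¹ i j * (ν : Euc n) i * (ν : Euc n) j)) (R • (ν : Euc n))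
    ∂((volume : Measure (Euc n)).toSphere)

end WeightedPoincare

end

/-! Put a = 2σ, b = 2μ and w = x^a r^b. This is a Hardy inequality, and it follows from a vector
field V on Ω with |V| ≤ C x w and Euclidean divergence at least c w, except on {x ≥ x₀, r ≤ R},
where the divergence is at least c w - C. For compactly supported u the integral of div(|u|² V)
vanishes. Metric compatibility and Cauchy–Schwarz bound the derivative of |u|² along V by 2 |V| |u|
|∇u|, and Young's inequality absorbs this into half of c w |u|² plus a multiple of x² w |∇u|². The
divergence is the flat one and is integrated against Lebesgue measure, so derivatives of g enter
only through ∇u; uniform comparability of g with the Euclidean metric is enough, and no decay rate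
is needed.

The field is V = x^(a+1) (s r^b ∇x + κ χ r^(b-1) p), with χ a cutoff to a neighbourhood of infinity.
Up to errors of size (x/r) w, the first summand has divergence s (a+1) |∇x|² w, and s = 1/(a+1)
makes the coefficient one; this uses σ ≠ -1/2. Where χ = 1, Euler's identity gives the second
summand the exact divergence κ (a+b+n) (x/r) w; since σ + μ + n/2 ≠ 0, κ can be chosen so that this
beats all errors, whatever the signs. Compactness up to the boundary and scaling show that |∇x|² +
x/r is bounded below, which yields div V ≥ c w far out. On the bounded part the errors are small
when x < x₀, and the rest is covered by the volume term of the right-hand side. The sphere integral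
is nonnegative and only enlarges that side.

The main lemmas are `exists_scaledBounds` (geometry of x and r), `exists_hardy_field` (the field),
`sq_fderiv_normSq_le` (tensor calculus) and `hardy_pointwise` (absorption). -/

namespace WeightedPoincare

/-! ### Limits of derivatives at boundary points. -/

section Limits

variable {E F : Type*} [NormedAddCommGroup E] [NormedSpace ℝ E]
  [NormedAddCommGroup F] [NormedSpace ℝ F]

/-- A function of class `C^{m+1}` up to the boundary of an open set has a derivative extending
in class `C^m` up to the boundary. -/
theorem exists_deriv_extension {Ω : Set E} (hΩ : IsOpen Ω) {f : E → F} {p : E}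
    (hp : p ∈ closure Ω) {m : ℕ} (hf : ContDiffWithinAt ℝ ((m : ℕ∞ω) + 1) f (closure Ω) p) :
    ∃ f' : E → E →L[ℝ] F, HasFDerivWithinAt f (f' p) (closure Ω) p ∧
      ContDiffWithinAt ℝ m f' (closure Ω) p ∧ fderiv ℝ f =ᶠ[𝓝[Ω] p] f' := by
  obtain ⟨u, hu, hus, -, f', hf', hcd⟩ :=
    (contDiffWithinAt_succ_iff_hasFDerivWithinAt' (by simp)).1 hf
  rw [insert_eq_of_mem hp] at hu hus
  refine ⟨f', hf' p (mem_of_mem_nhdsWithin hp hu), hcd, ?_⟩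
  filter_upwards [nhdsWithin_mono p subset_closure hu, self_mem_nhdsWithin] with q hq hqΩ
  exact ((hf' q hq).hasFDerivAt (mem_of_superset (hΩ.mem_nhds hqΩ) subset_closure)).fderiv

/-- Smoothness on the closure provides local derivatives that agree with `fderiv` inside Ω, so the
interior first derivative and the norm of the second have finite limits at boundary points. The
limit X is also a derivative within the closure, which links it to the condition dx ≠ 0. -/
theorem exists_tendsto_fderiv {Ω : Set E} (hΩ : IsOpen Ω) {f : E → F} {p : E}
    (hp : p ∈ closure Ω) (hf : ContDiffWithinAt ℝ ∞ f (closure Ω) p) :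
    ∃ X : E →L[ℝ] F, ∃ Y : E →L[ℝ] E →L[ℝ] F, HasFDerivWithinAt f X (closure Ω) p ∧
      Tendsto (fderiv ℝ f) (𝓝[Ω] p) (𝓝 X) ∧
      Tendsto (fun q => ‖fderiv ℝ (fderiv ℝ f) q‖) (𝓝[Ω] p) (𝓝 ‖Y‖) := by
  obtain ⟨f', hX, hc, he⟩ := exists_deriv_extension hΩ hp (m := 1)
    (hf.of_le (by norm_cast))
  obtain ⟨f'', -, hc', he'⟩ := exists_deriv_extension hΩ hp (m := 0)
    (f := f') (by simpa using hc)
  refine ⟨f' p, f'' p, hX, ?_, ?_⟩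
  · exact (hc.continuousWithinAt.mono_left (nhdsWithin_mono p subset_closure)).congr' he.symm
  · refine Tendsto.norm ((hc'.continuousWithinAt.mono_left
      (nhdsWithin_mono p subset_closure)).congr' ?_)
    have h2 := eventually_eventually_nhdsWithin.2 he
    filter_upwards [h2, he', self_mem_nhdsWithin] with q hq hq' hqΩ
    rw [hΩ.nhdsWithin_eq hqΩ] at hq
    rw [← hq', Filter.EventuallyEq.fderiv_eq hq]

theorem norm_of_smul_eq {t : ℝ} (ht : 0 < t) {S T : E →L[ℝ] F} (h : t • S = T) :
    t * ‖S‖ = ‖T‖ := by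
  rw [← h, norm_smul, Real.norm_of_nonneg ht.le]

end Limits

/-! ### Homogeneity, Euler identities and scale invariant bounds for x and r. -/

variable {n : ℕ} {Ω : Set (Euc n)} {R₀ : ℝ} {x r : Euc n → ℝ}

/-- Factors p through the sphere of radius R₀. Shrinking is allowed too, as long as the point stays
outside the ball; this serves two-sided derivatives along rays and rescaling to a fixed sphere. -/
theorem IsScaleInvariantDomain.smul_mem (hΩ : IsScaleInvariantDomain Ω R₀) {p : Euc n}
    (hp : p ∈ Ω) (hpR : R₀ ≤ ‖p‖) {s : ℝ} (hs : R₀ ≤ s * ‖p‖) : s • p ∈ Ω := by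
  have h1 := hΩ.one_le
  have hmem : p ∈ Ω \ Metric.ball 0 R₀ := ⟨hp, by simpa using hpR⟩
  rw [hΩ.scaling] at hmem
  obtain ⟨q, ⟨hq, hqR⟩, t, ht, rfl⟩ := hmem
  have hqn : ‖q‖ = R₀ := by simpa using hqR
  rw [norm_smul, Real.norm_of_nonneg (by linarith), hqn] at hs
  have hst : 1 ≤ s * t := by
    by_contra! h
    nlinarith
  have : s • t • q ∈ Ω \ Metric.ball 0 R₀ := by
    rw [hΩ.scaling]
    exact ⟨q, ⟨hq, hqR⟩, s * t, hst, by rw [smul_smul]⟩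
  exact this.1

theorem IsScalingDefiningFunction.smul_eq (hΩ : IsScaleInvariantDomain Ω R₀)
    (hx : IsScalingDefiningFunction Ω R₀ x) {p : Euc n}
    (hp : p ∈ Ω) (hpR : R₀ ≤ ‖p‖) {s : ℝ} (hs : R₀ ≤ s * ‖p‖) : x (s • p) = s * x p := by
  have h1 := hΩ.one_le
  have hs0 : 0 < s := by
    by_contra! h
    nlinarith [norm_nonneg p]
  have hsm := hΩ.smul_mem hp hpR hs
  have hn : ‖s • p‖ = s * ‖p‖ := by rw [norm_smul, Real.norm_of_nonneg hs0.le]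
  have hA : p ∈ Ω \ Metric.ball 0 R₀ := ⟨hp, by simpa using hpR⟩
  have hB : s • p ∈ Ω \ Metric.ball 0 R₀ := ⟨hsm, by simpa [hn] using hs⟩
  rcases le_total 1 s with h | h
  · exact hx.homogeneous p s h hA hB
  · have hinv : s⁻¹ • s • p = p := by rw [smul_smul, inv_mul_cancel₀ hs0.ne', one_smul]
    have := hx.homogeneous (s • p) s⁻¹ (one_le_inv_iff₀.2 ⟨hs0, h⟩) hB (by rwa [hinv])
    rw [hinv] at this
    rw [this]
    field_simp

theorem contDiffAt_of_closure {f : Euc n → ℝ} (hΩ : IsOpen Ω)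
    (hf : ContDiffOn ℝ ∞ f (closure Ω)) {p : Euc n} (hp : p ∈ Ω) : ContDiffAt ℝ ∞ f p :=
  (hf.mono subset_closure).contDiffAt (hΩ.mem_nhds hp)

/-- Euler's identity for a function which is homogeneous of degree one near a ray. -/
theorem fderiv_self_of_homogeneous {f : Euc n → ℝ} {p : Euc n} (hf : DifferentiableAt ℝ f p)
    (h : ∀ᶠ t : ℝ in 𝓝 1, f (t • p) = t * f p) : fderiv ℝ f p p = f p := by
  have h1 : HasDerivAt (fun t : ℝ => f (t • p)) (fderiv ℝ f p p) 1 := by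
    have h2 : HasDerivAt (fun t : ℝ => t • p) p 1 := by
      simpa using (hasDerivAt_id (1 : ℝ)).smul_const p
    have h3 : HasFDerivAt f (fderiv ℝ f p) ((1 : ℝ) • p) := by simpa using hf.hasFDerivAt
    exact h3.comp_hasDerivAt (1 : ℝ) h2
  have h2 : HasDerivAt (fun t : ℝ => t * f p) (f p) 1 := by
    simpa using (hasDerivAt_id (1 : ℝ)).mul_const (f p)
  exact h1.unique (h2.congr_of_eventuallyEq h)

theorem eventually_le_mul_norm {p : Euc n} (hp : R₀ < ‖p‖) : ∀ᶠ t : ℝ in 𝓝 1, R₀ ≤ t * ‖p‖ := by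
  have : ContinuousAt (fun t : ℝ => t * ‖p‖) 1 := by fun_prop
  exact (this.eventually_const_lt (by simpa using hp)).mono fun _ h => h.le

theorem IsScalingDefiningFunction.euler (hΩ : IsScaleInvariantDomain Ω R₀)
    (hx : IsScalingDefiningFunction Ω R₀ x) {p : Euc n} (hp : p ∈ Ω) (hpR : R₀ < ‖p‖) :
    fderiv ℝ x p p = x p := by
  refine fderiv_self_of_homogeneous
    ((contDiffAt_of_closure hΩ.isOpen hx.smooth hp).differentiableAt (by simp)) ?_
  filter_upwards [eventually_le_mul_norm hpR] with t ht using hx.smul_eq hΩ hp hpR.le ht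

theorem IsRadialFunction.eventuallyEq_norm (hΩ : IsScaleInvariantDomain Ω R₀)
    (hr : IsRadialFunction Ω R₀ r) {p : Euc n} (hp : p ∈ Ω) (hpR : R₀ < ‖p‖) :
    r =ᶠ[𝓝 p] fun q => ‖q‖ := by
  filter_upwards [hΩ.isOpen.mem_nhds hp, continuous_norm.continuousAt.eventually_const_lt hpR]
    with q hq hqR
  exact hr.eq_norm q ⟨hq, by simpa using hqR.le⟩

theorem IsRadialFunction.euler (hΩ : IsScaleInvariantDomain Ω R₀)
    (hr : IsRadialFunction Ω R₀ r) {p : Euc n} (hp : p ∈ Ω) (hpR : R₀ < ‖p‖) :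
    fderiv ℝ r p p = r p := by
  have h1 := hΩ.one_le
  refine fderiv_self_of_homogeneous
    ((contDiffAt_of_closure hΩ.isOpen hr.smooth hp).differentiableAt (by simp)) ?_
  filter_upwards [eventually_le_mul_norm hpR] with t ht
  have ht0 : 0 < t := by
    by_contra! h
    nlinarith [norm_nonneg p]
  have hn : ‖t • p‖ = t * ‖p‖ := by rw [norm_smul, Real.norm_of_nonneg ht0.le]
  rw [hr.eq_norm (t • p) ⟨hΩ.smul_mem hp hpR.le ht, by simpa [hn] using ht⟩,
    hr.eq_norm p ⟨hp, by simpa using hpR.le⟩, hn]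

/-- The bounds on `x` and `r` that hold on bounded parts of `Ω`. -/
def LocalBounds (x r : Euc n → ℝ) (C : ℝ) (p : Euc n) : Prop :=
  ‖fderiv ℝ x p‖ ≤ C ∧ ‖fderiv ℝ (fderiv ℝ x) p‖ ≤ C ∧ ‖fderiv ℝ r p‖ ≤ C ∧ x p ≤ C ∧ r p ≤ C ∧
    1 ≤ C * (‖fderiv ℝ x p‖ ^ 2 + x p)

theorem LocalBounds.mono {C D : ℝ} {p : Euc n} (h : LocalBounds x r C p) (hx : 0 ≤ x p)
    (hCD : C ≤ D) : LocalBounds x r D p := by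
  obtain ⟨h1, h2, h3, h4, h5, h6⟩ := h
  exact ⟨h1.trans hCD, h2.trans hCD, h3.trans hCD, h4.trans hCD, h5.trans hCD,
    h6.trans (by gcongr)⟩

theorem exists_nhds_localBounds (hΩ : IsScaleInvariantDomain Ω R₀)
    (hx : IsScalingDefiningFunction Ω R₀ x) (hr : IsRadialFunction Ω R₀ r) {p : Euc n}
    (hp : p ∈ closure Ω) : ∃ C : ℝ, ∀ᶠ q in 𝓝[Ω] p, LocalBounds x r C q := by
  obtain ⟨X, Y, hX, hX', hY⟩ := exists_tendsto_fderiv hΩ.isOpen hp (hx.smooth p hp)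
  obtain ⟨Z, -, -, hZ, -⟩ := exists_tendsto_fderiv hΩ.isOpen hp (hr.smooth p hp)
  have hxc : Tendsto x (𝓝[Ω] p) (𝓝 (x p)) :=
    (hx.smooth p hp).continuousWithinAt.mono_left (nhdsWithin_mono p subset_closure)
  have hrc : Tendsto r (𝓝[Ω] p) (𝓝 (r p)) :=
    (hr.smooth p hp).continuousWithinAt.mono_left (nhdsWithin_mono p subset_closure)
  have hpos : 0 < ‖X‖ ^ 2 + x p := by
    by_cases hpΩ : p ∈ Ω
    · have := hx.pos p hpΩ
      positivity
    · have hfr : p ∈ frontier Ω := ⟨hp, by rwa [hΩ.isOpen.interior_eq]⟩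
      rw [hx.zero p hfr, add_zero]
      -- `fderivWithin` takes the value zero whenever zero is a derivative within the set, so X = 0
      -- contradicts dx ≠ 0 without any uniqueness of such derivatives.
      have : X ≠ 0 := by
        rintro rfl
        apply hx.deriv_ne_zero p hfr
        rw [fderivWithin, if_pos hX]
      positivity
  set m := ‖X‖ ^ 2 + x p with hm
  have hlim : Tendsto (fun q => ‖fderiv ℝ x q‖ ^ 2 + x q) (𝓝[Ω] p) (𝓝 m) :=
    (hX'.norm.pow 2).add hxc
  refine ⟨max (‖X‖ + 1) (max (‖Y‖ + 1) (max (‖Z‖ + 1) (max (x p + 1) (max (r p + 1) (2 / m))))), ?_⟩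
  filter_upwards [hX'.norm.eventually_lt_const (lt_add_one _),
    hY.eventually_lt_const (lt_add_one _), hZ.norm.eventually_lt_const (lt_add_one _),
    hxc.eventually_lt_const (lt_add_one _), hrc.eventually_lt_const (lt_add_one _),
    hlim.eventually_const_lt (half_lt_self hpos)] with q h1 h2 h3 h4 h5 h6
  refine ⟨?_, ?_, ?_, ?_, ?_, ?_⟩
  · exact h1.le.trans (by simp)
  · exact h2.le.trans (by simp)
  · exact h3.le.trans (by simp)
  · exact h4.le.trans (by simp)
  · exact h5.le.trans (by simp)
  · calc (1 : ℝ) = 2 / m * (m / 2) := by field_simp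
      _ ≤ _ := mul_le_mul (by simp) h6.le (by positivity) (le_max_of_le_left (by positivity))

/-- The local bounds hold near every point of the closure, boundary included, and bounded closed
pieces of the closure are compact. -/
theorem exists_localBounds (hΩ : IsScaleInvariantDomain Ω R₀)
    (hx : IsScalingDefiningFunction Ω R₀ x) (hr : IsRadialFunction Ω R₀ r) (ρ : ℝ) :
    ∃ C : ℝ, ∀ p ∈ Ω, ‖p‖ ≤ ρ → LocalBounds x r C p := by
  have hK : IsCompact (closure Ω ∩ Metric.closedBall 0 ρ) :=
    (isCompact_closedBall 0 ρ).inter_left isClosed_closure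
  have := hK.induction_on (p := fun s => ∃ C : ℝ, ∀ p ∈ Ω ∩ s, LocalBounds x r C p)
    ⟨0, by simp⟩ (fun s t hst ⟨C, hC⟩ => ⟨C, fun p hp => hC p ⟨hp.1, hst hp.2⟩⟩) ?_ ?_
  · obtain ⟨C, hC⟩ := this
    exact ⟨C, fun p hp hpρ => hC p ⟨hp, subset_closure hp, by simpa using hpρ⟩⟩
  · rintro s t ⟨C, hC⟩ ⟨D, hD⟩
    refine ⟨max C D, ?_⟩
    rintro p ⟨hp, hs | ht⟩
    · exact (hC p ⟨hp, hs⟩).mono (hx.pos p hp).le (le_max_left _ _)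
    · exact (hD p ⟨hp, ht⟩).mono (hx.pos p hp).le (le_max_right _ _)
  · intro p hp
    obtain ⟨C, hC⟩ := exists_nhds_localBounds hΩ hx hr hp.1
    obtain ⟨t, ht, htC⟩ := mem_nhdsWithin_iff_exists_mem_nhds_inter.1 hC
    exact ⟨t, mem_nhdsWithin_of_mem_nhds ht, C, fun q hq => htC ⟨hq.2, hq.1⟩⟩

/-- The scale invariant bounds on `x` and `r` that hold on all of `Ω`. -/
def ScaledBounds (x r : Euc n → ℝ) (C : ℝ) (p : Euc n) : Prop :=
  ‖fderiv ℝ x p‖ ≤ C ∧ r p * ‖fderiv ℝ (fderiv ℝ x) p‖ ≤ C ∧ ‖fderiv ℝ r p‖ ≤ C ∧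
    x p ≤ C * r p ∧ 1 ≤ C * (‖fderiv ℝ x p‖ ^ 2 + x p / r p)

/-- The first two derivatives of a function that is homogeneous of degree one. -/
theorem IsScalingDefiningFunction.fderiv_smul (hΩ : IsScaleInvariantDomain Ω R₀)
    (hx : IsScalingDefiningFunction Ω R₀ x) {q : Euc n} (hq : q ∈ Ω) (hqR : R₀ < ‖q‖)
    {t : ℝ} (ht : 1 ≤ t) : fderiv ℝ x (t • q) = fderiv ℝ x q ∧
      t • fderiv ℝ (fderiv ℝ x) (t • q) = fderiv ℝ (fderiv ℝ x) q := by
  have hev : ∀ᶠ y in 𝓝 q, y ∈ Ω ∧ R₀ < ‖y‖ :=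
    (hΩ.isOpen.eventually_mem hq).and (continuous_norm.continuousAt.eventually_const_lt hqR)
  have h1 : ∀ y, y ∈ Ω → R₀ < ‖y‖ → fderiv ℝ x (t • y) = fderiv ℝ x y := by
    intro y hy hyR
    have he : (fun z => x (t • z)) =ᶠ[𝓝 y] fun z => t • x z := by
      filter_upwards [hΩ.isOpen.mem_nhds hy,
        continuous_norm.continuousAt.eventually_const_lt hyR] with z hz hzR
      refine hx.smul_eq hΩ hz hzR.le (hzR.le.trans (le_mul_of_one_le_left (norm_nonneg _) ht))
    have h := he.fderiv_eq (𝕜 := ℝ)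
    rw [fderiv_comp_smul, fderiv_fun_const_smul
      ((contDiffAt_of_closure hΩ.isOpen hx.smooth hy).differentiableAt (by simp))] at h
    exact smul_right_injective _ (by linarith : t ≠ 0) h
  refine ⟨h1 q hq hqR, ?_⟩
  rw [← fderiv_comp_smul (𝕜 := ℝ)]
  exact Filter.EventuallyEq.fderiv_eq (hev.mono fun y hy => h1 y hy.1 hy.2)

/-- Every quantity involved is invariant under dilations far out, so its bounds there reduce to the
sphere of radius 2 R₀ and hence to a bounded region. -/
theorem exists_scaledBounds (hΩ : IsScaleInvariantDomain Ω R₀)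
    (hx : IsScalingDefiningFunction Ω R₀ x) (hr : IsRadialFunction Ω R₀ r) :
    ∃ C : ℝ, 0 < C ∧ ∀ p ∈ Ω, ScaledBounds x r C p := by
  have hR := hΩ.one_le
  obtain ⟨D, hD⟩ := exists_localBounds hΩ hx hr (2 * R₀)
  obtain ⟨δ, hδ, hrδ⟩ := hr.bounded_below
  set A := max D 1
  have hA1 : 1 ≤ A := le_max_right _ _
  have hA : ∀ p ∈ Ω, ‖p‖ ≤ 2 * R₀ → LocalBounds x r A p := fun p hp h =>
    (hD p hp h).mono (hx.pos p hp).le (le_max_left _ _)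
  -- The first summand dominates A, A² and 2 R₀ A; the second gives x ≤ A ≤ (A/δ) r where r is
  -- merely bounded below by δ.
  set C := 2 * A * A * R₀ + A / δ with hC
  have hAA : A ≤ A * A * R₀ := by nlinarith [mul_le_mul hA1 hR (by norm_num) (by linarith)]
  have hAA2 : A * A ≤ A * A * R₀ := le_mul_of_one_le_right (by positivity) hR
  have hAR : A * R₀ ≤ A * A * R₀ := by
    have : A ≤ A * A := by nlinarith
    gcongr
  have hAδ : 0 < A / δ := by positivity
  refine ⟨C, by positivity, fun p hp => ?_⟩
  have hrp := hrδ p hp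
  have hr0 : 0 < r p := by linarith
  have hx0 := hx.pos p hp
  rcases le_or_gt ‖p‖ (2 * R₀) with hpR | hpR
  · obtain ⟨h1, h2, h3, h4, h5, h6⟩ := hA p hp hpR
    refine ⟨by nlinarith, ?_, by nlinarith, ?_, ?_⟩
    · have : r p * ‖fderiv ℝ (fderiv ℝ x) p‖ ≤ A * A := by gcongr
      nlinarith
    · have : A ≤ A / δ * r p := by
        rw [div_mul_eq_mul_div, le_div_iff₀ hδ]
        gcongr
      have : 0 ≤ 2 * A * A * R₀ * r p := by positivity
      rw [hC, add_mul]
      linarith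
    · have e1 : A * x p ≤ (A * A) * (x p / r p) := by
        rw [mul_div_assoc', le_div_iff₀ hr0]
        calc A * x p * r p ≤ A * x p * A := by gcongr
          _ = _ := by ring
      have e2 : A * ‖fderiv ℝ x p‖ ^ 2 ≤ C * ‖fderiv ℝ x p‖ ^ 2 := by
        gcongr; nlinarith
      have e3 : (A * A) * (x p / r p) ≤ C * (x p / r p) := by
        gcongr; nlinarith
      calc 1 ≤ A * (‖fderiv ℝ x p‖ ^ 2 + x p) := h6
        _ ≤ _ := by rw [mul_add, mul_add]; linarith
  -- Rescaling to radius 2 R₀ rather than R₀ leaves a full neighbourhood of q on which homogeneity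
  -- holds and can be differentiated.
  · set t := ‖p‖ / (2 * R₀) with ht
    have ht1 : 1 ≤ t := by rw [ht, le_div_iff₀ (by positivity)]; linarith
    have ht0 : 0 < t := by linarith
    have hpn : ‖p‖ = t * (2 * R₀) := by rw [ht]; field_simp
    set q := t⁻¹ • p with hq
    have hpq : p = t • q := by rw [hq, smul_smul, mul_inv_cancel₀ ht0.ne', one_smul]
    have hqn : ‖q‖ = 2 * R₀ := by
      rw [hq, norm_smul, Real.norm_of_nonneg (by positivity), hpn]
      field_simp
    have hqΩ : q ∈ Ω := hΩ.smul_mem hp (by linarith) (by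
      rw [hpn, inv_mul_cancel_left₀ ht0.ne']; linarith)
    obtain ⟨h1, h2, h3, h4, h5, h6⟩ := hA q hqΩ hqn.le
    obtain ⟨d1, d2⟩ := hx.fderiv_smul hΩ hqΩ (by linarith) ht1
    have hxp : x p = t * x q := by
      rw [hpq]
      exact hx.smul_eq hΩ hqΩ (by linarith) (by rw [hqn]; nlinarith)
    have hrp' : r p = t * (2 * R₀) := by
      rw [← hpn]
      exact hr.eq_norm p ⟨hp, by rw [mem_ball_zero_iff]; linarith⟩
    have hxq := hx.pos q hqΩ
    rw [← hpq] at d1 d2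
    unfold ScaledBounds
    rw [d1]
    have hAC : A ≤ C := by linarith
    have hARC : A * (2 * R₀) ≤ C := by linarith
    refine ⟨h1.trans hAC, ?_, ?_, ?_, ?_⟩
    · have : t * ‖fderiv ℝ (fderiv ℝ x) p‖ ≤ A := by
        rwa [norm_of_smul_eq (E := Euc n) (F := Euc n →L[ℝ] ℝ) ht0 d2]
      calc r p * ‖fderiv ℝ (fderiv ℝ x) p‖ = 2 * R₀ * (t * ‖fderiv ℝ (fderiv ℝ x) p‖) := by
            rw [hrp']; ring
        _ ≤ 2 * R₀ * A := by gcongr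
        _ ≤ C := by linarith
    · have he := (hr.eventuallyEq_norm hΩ hp (by linarith)).fderiv_eq (𝕜 := ℝ)
      rw [he]
      have : ‖fderiv ℝ (fun q : Euc n => ‖q‖) p‖ ≤ (1 : NNReal) :=
        norm_fderiv_le_of_lipschitz ℝ lipschitzWith_one_norm
      simp only [NNReal.coe_one] at this
      exact this.trans (hA1.trans hAC)
    · rw [hxp, hrp']
      have e : x q ≤ C * (2 * R₀) := h4.trans (hAC.trans
        (le_mul_of_one_le_right (hAδ.le.trans (by linarith)) (by linarith)))
      calc t * x q ≤ t * (C * (2 * R₀)) := by gcongr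
        _ = _ := by ring
    · have e : x p / r p = x q / (2 * R₀) := by
        rw [hxp, hrp', mul_div_mul_left _ _ ht0.ne']
      rw [e]
      have e1 : A * x q ≤ C * (x q / (2 * R₀)) := by
        rw [mul_div_assoc', le_div_iff₀ (by positivity)]
        nlinarith
      have e2 : A * ‖fderiv ℝ x q‖ ^ 2 ≤ C * ‖fderiv ℝ x q‖ ^ 2 := by
        gcongr
      calc 1 ≤ A * (‖fderiv ℝ x q‖ ^ 2 + x q) := h6
        _ ≤ _ := by rw [mul_add, mul_add]; linarith

/-! ### Differentiating the inner product of tensors along a curve. -/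

section Algebra

variable {n k l : ℕ}

/-- The pairing of two tensors given by a matrix `P` on upper and a matrix `N` on lower
multi-indices. -/
def pairing (P : (Fin k → Fin n) → (Fin k → Fin n) → ℝ)
    (N : (Fin l → Fin n) → (Fin l → Fin n) → ℝ) (T T' : TensorComp n k l) : ℝ :=
  ∑ I', ∑ J', (∑ J, N J J' * ∑ I, P I I' * T I J) * T' I' J'

/-- The matrix `∏ₛ G (I s) (I' s)` on multi-indices. -/
def prodMatrix (G : Matrix (Fin n) (Fin n) ℝ) (I I' : Fin k → Fin n) : ℝ := ∏ s, G (I s) (I' s)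

theorem normSq_eq_pairing (G : Matrix (Fin n) (Fin n) ℝ) (T : TensorComp n k l) :
    normSq G T = pairing (prodMatrix G) (prodMatrix G⁻¹) T T := by
  unfold normSq pairing prodMatrix
  rw [Finset.sum_comm]
  refine Finset.sum_congr rfl fun I' _ => ?_
  simp only [Finset.sum_mul, Finset.mul_sum]
  rw [Finset.sum_comm' (t' := Finset.univ) (s' := fun _ => Finset.univ) (by simp), Finset.sum_comm]
  rw [Finset.sum_congr rfl fun J' _ => Finset.sum_comm]
  rw [Finset.sum_comm]
  refine Finset.sum_congr rfl fun J' _ => ?_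
  rw [Finset.sum_comm]
  refine Finset.sum_congr rfl fun J _ => Finset.sum_congr rfl fun I _ => by ring


/-- Exchanging the entry at s with the free index m is an involution on pairs (I, m). -/
theorem sum_update_comm (s : Fin k) (f : (Fin k → Fin n) → Fin n → ℝ) :
    ∑ I, ∑ m, f I m = ∑ I, ∑ m, f (Function.update I s m) (I s) := by
  rw [← Fintype.sum_prod_type', ← Fintype.sum_prod_type' (f := fun I m =>
    f (Function.update I s m) (I s))]
  refine Finset.sum_nbij' (fun q => (Function.update q.1 s q.2, q.1 s))
    (fun q => (Function.update q.1 s q.2, q.1 s)) ?_ ?_ ?_ ?_ ?_ <;> simp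

/-- The action of a matrix on multi-indexed arrays as a derivation. -/
def derivAction (M : Matrix (Fin n) (Fin n) ℝ) (Y : (Fin k → Fin n) → ℝ) (I : Fin k → Fin n) : ℝ :=
  ∑ s, ∑ m, M (I s) m * Y (Function.update I s m)

/-- The derivative of `prodMatrix G` in a direction in which that of `G` is `Mᵀ G`. -/
def leftDeriv (M : Matrix (Fin n) (Fin n) ℝ) (P : (Fin k → Fin n) → (Fin k → Fin n) → ℝ)
    (I I' : Fin k → Fin n) : ℝ := ∑ s, ∑ m, P (Function.update I s m) I' * M m (I s)

/-- Summation by parts on indices: the change of the metric is moved onto the tensor, where it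
becomes the connection term. -/
theorem sum_leftDeriv_mul (M : Matrix (Fin n) (Fin n) ℝ)
    (P : (Fin k → Fin n) → (Fin k → Fin n) → ℝ) (Y : (Fin k → Fin n) → ℝ) (I' : Fin k → Fin n) :
    ∑ I, leftDeriv M P I I' * Y I = ∑ I, P I I' * derivAction M Y I := by
  simp only [leftDeriv, derivAction, Finset.sum_mul, Finset.mul_sum]
  rw [Finset.sum_comm, Finset.sum_comm (γ := Fin k → Fin n)]
  refine Finset.sum_congr rfl fun s _ => ?_
  rw [sum_update_comm s]
  refine Finset.sum_congr rfl fun I _ => Finset.sum_congr rfl fun m _ => ?_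
  simp
  ring

theorem pairing_leftDeriv_left (M : Matrix (Fin n) (Fin n) ℝ)
    (P : (Fin k → Fin n) → (Fin k → Fin n) → ℝ) (N : (Fin l → Fin n) → (Fin l → Fin n) → ℝ)
    (T T' : TensorComp n k l) :
    pairing (leftDeriv M P) N T T' =
      pairing P N (fun I J => derivAction M (fun I => T I J) I) T' := by
  simp only [pairing, ← sum_leftDeriv_mul]

theorem sum_mul_derivAction (M : Matrix (Fin n) (Fin n) ℝ) (w : (Fin k → Fin n) → ℝ)
    (T : TensorComp n k l) (J : Fin l → Fin n) :
    derivAction M (fun J => ∑ I, w I * T I J) J = ∑ I, w I * derivAction M (T I) J := by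
  simp only [derivAction, Finset.mul_sum]
  rw [Finset.sum_comm' (t' := Finset.univ) (s' := fun _ => Finset.univ) (by simp)]
  rw [Finset.sum_comm (γ := Fin k → Fin n), Finset.sum_comm]
  refine Finset.sum_congr rfl fun s _ => ?_
  rw [Finset.sum_comm]
  exact Finset.sum_congr rfl fun I _ => Finset.sum_congr rfl fun m _ => by ring

theorem pairing_leftDeriv_right (M : Matrix (Fin n) (Fin n) ℝ)
    (P : (Fin k → Fin n) → (Fin k → Fin n) → ℝ) (N : (Fin l → Fin n) → (Fin l → Fin n) → ℝ)
    (T T' : TensorComp n k l) :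
    pairing P (leftDeriv M N) T T' = pairing P N (fun I J => derivAction M (T I) J) T' := by
  simp only [pairing]
  refine Finset.sum_congr rfl fun I' _ => Finset.sum_congr rfl fun J' _ => ?_
  congr 1
  rw [sum_leftDeriv_mul M N (fun J => ∑ I, P I I' * T I J)]
  simp only [sum_mul_derivAction]

theorem pairing_comm {P : (Fin k → Fin n) → (Fin k → Fin n) → ℝ}
    {N : (Fin l → Fin n) → (Fin l → Fin n) → ℝ} (T T' : TensorComp n k l) :
    pairing P N T T' = pairing (fun I I' => P I' I) (fun J J' => N J' J) T' T := by
  simp only [pairing, Finset.mul_sum, Finset.sum_mul]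
  rw [Finset.sum_congr rfl fun I' _ => Finset.sum_congr rfl fun J' _ => Finset.sum_comm]
  rw [Finset.sum_congr rfl fun I' _ => Finset.sum_comm]
  rw [Finset.sum_comm]
  refine Finset.sum_congr rfl fun I _ => ?_
  rw [Finset.sum_congr rfl fun I' _ => Finset.sum_comm]
  rw [Finset.sum_comm]
  refine Finset.sum_congr rfl fun J _ => ?_
  rw [Finset.sum_comm]
  exact Finset.sum_congr rfl fun J' _ => Finset.sum_congr rfl fun I' _ => by ring

theorem pairing_add_upper (P P' : (Fin k → Fin n) → (Fin k → Fin n) → ℝ)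
    (N : (Fin l → Fin n) → (Fin l → Fin n) → ℝ) (T T' : TensorComp n k l) :
    pairing (P + P') N T T' = pairing P N T T' + pairing P' N T T' := by
  simp only [pairing, Pi.add_apply, add_mul, Finset.sum_add_distrib, mul_add]

theorem pairing_add_lower (P : (Fin k → Fin n) → (Fin k → Fin n) → ℝ)
    (N N' : (Fin l → Fin n) → (Fin l → Fin n) → ℝ) (T T' : TensorComp n k l) :
    pairing P (N + N') T T' = pairing P N T T' + pairing P N' T T' := by
  simp only [pairing, Pi.add_apply, add_mul, Finset.sum_add_distrib]

theorem pairing_add_left (P : (Fin k → Fin n) → (Fin k → Fin n) → ℝ)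
    (N : (Fin l → Fin n) → (Fin l → Fin n) → ℝ) (S T T' : TensorComp n k l) :
    pairing P N (S + T) T' = pairing P N S T' + pairing P N T T' := by
  simp only [pairing, Pi.add_apply, add_mul, Finset.sum_add_distrib, mul_add]

theorem pairing_smul_left (P : (Fin k → Fin n) → (Fin k → Fin n) → ℝ)
    (N : (Fin l → Fin n) → (Fin l → Fin n) → ℝ) (c : ℝ) (T T' : TensorComp n k l) :
    pairing P N (c • T) T' = c * pairing P N T T' := by
  simp only [pairing, Pi.smul_apply, smul_eq_mul, Finset.mul_sum, Finset.sum_mul]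
  refine Finset.sum_congr rfl fun I' _ => Finset.sum_congr rfl fun J' _ =>
    Finset.sum_congr rfl fun J _ => Finset.sum_congr rfl fun I _ => by ring

theorem prodMatrix_swap {G : Matrix (Fin n) (Fin n) ℝ} (hG : G.IsSymm) (I I' : Fin k → Fin n) :
    prodMatrix G I' I = prodMatrix G I I' := by
  simp only [prodMatrix]
  exact Finset.prod_congr rfl fun s _ => hG.apply _ _

theorem prodMatrix_update (G : Matrix (Fin n) (Fin n) ℝ) (I I' : Fin k → Fin n) (s : Fin k)
    (m : Fin n) : prodMatrix G (Function.update I s m) I' =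
      (∏ s' ∈ Finset.univ.erase s, G (I s') (I' s')) * G m (I' s) := by
  rw [prodMatrix, ← Finset.prod_erase_mul _ _ (Finset.mem_univ s)]
  congr 1
  · refine Finset.prod_congr rfl fun s' hs' => ?_
    rw [Function.update_of_ne (Finset.ne_of_mem_erase hs')]
  · simp

/-- The derivative of `prodMatrix G` in a direction in which that of `G` is `Mᵀ G + G M`. -/
theorem hasDerivAt_prodMatrix {G : ℝ → Matrix (Fin n) (Fin n) ℝ} {M : Matrix (Fin n) (Fin n) ℝ}
    {t : ℝ} (hG : ∀ i j, HasDerivAt (fun τ => G τ i j)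
      (∑ m, (G t m j * M m i + G t m i * M m j)) t) (hs : (G t).IsSymm) (I I' : Fin k → Fin n) :
    HasDerivAt (fun τ => prodMatrix (G τ) I I')
      (leftDeriv M (prodMatrix (G t)) I I' + leftDeriv M (prodMatrix (G t)) I' I) t := by
  have h := HasDerivAt.fun_finsetProd (u := Finset.univ) (f := fun s τ => G τ (I s) (I' s))
    fun s _ => hG (I s) (I' s)
  refine h.congr_deriv ?_
  simp only [leftDeriv, ← Finset.sum_add_distrib, smul_eq_mul]
  refine Finset.sum_congr rfl fun s _ => ?_
  rw [Finset.mul_sum]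
  refine Finset.sum_congr rfl fun m _ => ?_
  rw [prodMatrix_update, prodMatrix_update]
  have : ∏ s' ∈ Finset.univ.erase s, G t (I' s') (I s') =
      ∏ s' ∈ Finset.univ.erase s, G t (I s') (I' s') :=
    Finset.prod_congr rfl fun s _ => hs.apply _ _
  rw [this]
  ring

/-- **Metric compatibility** along a curve. -/
theorem hasDerivAt_pairing {G H : ℝ → Matrix (Fin n) (Fin n) ℝ} {M : Matrix (Fin n) (Fin n) ℝ}
    {t : ℝ} (hG : ∀ i j, HasDerivAt (fun τ => G τ i j)
      (∑ m, (G t m j * M m i + G t m i * M m j)) t) (hGs : (G t).IsSymm)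
    (hH : ∀ i j, HasDerivAt (fun τ => H τ i j)
      (∑ m, (H t m j * (-M.transpose) m i + H t m i * (-M.transpose) m j)) t) (hHs : (H t).IsSymm)
    {T : ℝ → TensorComp n k l} {S : TensorComp n k l}
    (hT : ∀ I J, HasDerivAt (fun τ => T τ I J) (S I J) t) :
    HasDerivAt (fun τ => pairing (prodMatrix (G τ)) (prodMatrix (H τ)) (T τ) (T τ))
      (2 * pairing (prodMatrix (G t)) (prodMatrix (H t))
        (fun I J => S I J + derivAction M (fun I => T t I J) I
          + derivAction (-M.transpose) (T t I) J) (T t)) t := by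
  set P := prodMatrix (k := k) (G t) with hP
  set N := prodMatrix (k := l) (H t) with hN
  set dP : (Fin k → Fin n) → (Fin k → Fin n) → ℝ :=
    leftDeriv M P + fun I I' => leftDeriv M P I' I with hdP
  set dN : (Fin l → Fin n) → (Fin l → Fin n) → ℝ :=
    leftDeriv (-M.transpose) N + fun I I' => leftDeriv (-M.transpose) N I' I with hdN
  have h : HasDerivAt (fun τ => pairing (prodMatrix (G τ)) (prodMatrix (H τ)) (T τ) (T τ))
      (pairing P dN (T t) (T t) + pairing dP N (T t) (T t) + pairing P N S (T t)
        + pairing P N (T t) S) t := by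
    have := HasDerivAt.fun_sum (u := Finset.univ) fun (I' : Fin k → Fin n) _ =>
      HasDerivAt.fun_sum (u := Finset.univ) fun (J' : Fin l → Fin n) _ =>
        (HasDerivAt.fun_sum (u := Finset.univ) fun (J : Fin l → Fin n) _ =>
          (hasDerivAt_prodMatrix hH hHs J J').mul
            (HasDerivAt.fun_sum (u := Finset.univ) fun (I : Fin k → Fin n) _ =>
              (hasDerivAt_prodMatrix hG hGs I I').mul (hT I J))).mul (hT I' J')
    refine this.congr_deriv ?_
    simp only [pairing, hdP, hdN, Pi.add_apply, ← Finset.sum_add_distrib]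
    refine Finset.sum_congr rfl fun I' _ => Finset.sum_congr rfl fun J' _ => ?_
    simp only [Finset.sum_add_distrib, mul_add, add_mul, Pi.mul_apply, ← hP, ← hN]
    ring
  refine h.congr_deriv ?_
  -- By symmetry of P and N, the terms differentiating the second slot equal those differentiating
  -- the first; this produces the factor two.
  have hPs : (fun I I' => P I' I) = P := by
    ext I I'; exact prodMatrix_swap hGs I I'
  have hNs : (fun I I' => N I' I) = N := by
    ext I I'; exact prodMatrix_swap hHs I I'
  have e1 : pairing P N (T t) S = pairing P N S (T t) := by
    rw [pairing_comm, hPs, hNs]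
  have e2 : pairing (fun I I' => leftDeriv M P I' I) N (T t) (T t) =
      pairing (leftDeriv M P) N (T t) (T t) := by
    rw [pairing_comm, hNs]
  have e3 : pairing P (fun I I' => leftDeriv (-M.transpose) N I' I) (T t) (T t) =
      pairing P (leftDeriv (-M.transpose) N) (T t) (T t) := by
    rw [pairing_comm, hPs]
  have e4 : (fun I J => S I J + derivAction M (fun I => T t I J) I
      + derivAction (-M.transpose) (T t I) J) = S + (fun I J => derivAction M (fun I => T t I J) I)
      + (fun I J => derivAction (-M.transpose) (T t I) J) := rfl
  rw [e4, pairing_add_left, pairing_add_left, hdP, hdN, pairing_add_upper, pairing_add_lower,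
    e1, e2, e3, pairing_leftDeriv_left, pairing_leftDeriv_right]
  ring

end Algebra

/-! ### Orthonormal frames and Cauchy–Schwarz for tensors. -/

section Frames

open Matrix

variable {n k l : ℕ}

theorem exists_eq_transpose_mul_self {G : Matrix (Fin n) (Fin n) ℝ} (hG : G.PosDef) :
    ∃ B : Matrix (Fin n) (Fin n) ℝ, G = Bᵀ * B := by
  open scoped MatrixOrder ComplexOrder in
  exact ⟨CFC.sqrt G, by
    have h := CFC.sqrt_mul_sqrt_self G hG.posSemidef.nonneg
    have h2 : (CFC.sqrt G).IsHermitian := (CFC.sqrt_nonneg G).posSemidef.1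
    rw [← conjTranspose_eq_transpose_of_trivial, h2.eq, h]⟩

/-- The components of a tensor in a frame given by the matrices `B` and `D`. -/
def frameComp (B D : Matrix (Fin n) (Fin n) ℝ) (T : TensorComp n k l) : TensorComp n k l :=
  fun c d => ∑ J, prodMatrix D d J * ∑ I, prodMatrix B c I * T I J

theorem prodMatrix_transpose_mul_self (B : Matrix (Fin n) (Fin n) ℝ) (I I' : Fin k → Fin n) :
    prodMatrix (Bᵀ * B) I I' = ∑ c, prodMatrix B c I * prodMatrix B c I' := by
  simp only [prodMatrix, Matrix.mul_apply, Matrix.transpose_apply, Finset.prod_univ_sum,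
    Fintype.piFinset_univ, Finset.prod_mul_distrib]

/-- Factoring both metrics turns the pairing into the standard dot product of frame components, so
positivity and Cauchy–Schwarz become those of finite sums. -/
theorem pairing_transpose_mul_self (B D : Matrix (Fin n) (Fin n) ℝ) (T T' : TensorComp n k l) :
    pairing (prodMatrix (Bᵀ * B)) (prodMatrix (Dᵀ * D)) T T' =
      ∑ c, ∑ d, frameComp B D T c d * frameComp B D T' c d := by
  have h1 : ∀ I' J, ∑ I, prodMatrix (Bᵀ * B) I I' * T I J =
      ∑ c, prodMatrix B c I' * ∑ I, prodMatrix B c I * T I J := by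
    intro I' J
    simp only [prodMatrix_transpose_mul_self, Finset.sum_mul, Finset.mul_sum]
    rw [Finset.sum_comm]
    exact Finset.sum_congr rfl fun c _ => Finset.sum_congr rfl fun I _ => by ring
  have h2 : ∀ I' J', ∑ J, prodMatrix (Dᵀ * D) J J' * ∑ I, prodMatrix (Bᵀ * B) I I' * T I J =
      ∑ c, ∑ d, prodMatrix B c I' * prodMatrix D d J' * frameComp B D T c d := by
    intro I' J'
    simp only [h1, frameComp]
    simp only [prodMatrix_transpose_mul_self, Finset.sum_mul, Finset.mul_sum]
    rw [Finset.sum_comm]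
    refine Finset.sum_congr rfl fun c _ => ?_
    rw [Finset.sum_congr rfl fun I _ => Finset.sum_comm, Finset.sum_comm]
    exact Finset.sum_congr rfl fun d _ => Finset.sum_congr rfl fun J _ =>
      Finset.sum_congr rfl fun I _ => by ring
  simp only [pairing, h2]
  have h3 : ∀ c d, frameComp B D T c d * frameComp B D T' c d =
      ∑ I', ∑ J', prodMatrix B c I' * prodMatrix D d J' * frameComp B D T c d * T' I' J' := by
    intro c d
    rw [frameComp.eq_def B D T']
    simp only [Finset.mul_sum]
    rw [Finset.sum_comm]
    exact Finset.sum_congr rfl fun I' _ => Finset.sum_congr rfl fun J' _ => by ring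
  simp only [h3, Finset.sum_mul]
  rw [Finset.sum_congr rfl fun I' _ => Finset.sum_comm, Finset.sum_comm]
  refine Finset.sum_congr rfl fun c _ => ?_
  rw [Finset.sum_congr rfl fun I' _ => Finset.sum_comm, Finset.sum_comm]

theorem sum_fin_cons (f : (Fin (l + 1) → Fin n) → ℝ) :
    ∑ J, f J = ∑ e, ∑ d : Fin l → Fin n, f (Fin.cons e d) := by
  rw [← Fintype.sum_prod_type']
  exact (Fintype.sum_equiv (Fin.consEquiv fun _ => Fin n) _ _ fun _ => rfl).symm

theorem prodMatrix_cons (D : Matrix (Fin n) (Fin n) ℝ) (e a : Fin n) (d J : Fin l → Fin n) :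
    prodMatrix D (Fin.cons e d : Fin (l + 1) → Fin n) (Fin.cons a J : Fin (l + 1) → Fin n) =
      D e a * prodMatrix D d J := by
  simp [prodMatrix, Fin.prod_univ_succ]

theorem frameComp_cons (B D : Matrix (Fin n) (Fin n) ℝ) (S : TensorComp n k (l + 1))
    (c : Fin k → Fin n) (e : Fin n) (d : Fin l → Fin n) :
    frameComp B D S c (Fin.cons e d) =
      ∑ a, D e a * frameComp B D (fun I J => S I (Fin.cons a J)) c d := by
  simp only [frameComp]
  rw [sum_fin_cons]
  refine Finset.sum_congr rfl fun a _ => ?_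
  rw [Finset.mul_sum]
  exact Finset.sum_congr rfl fun J _ => by rw [prodMatrix_cons]; ring

theorem frameComp_sum (B D : Matrix (Fin n) (Fin n) ℝ) (v : Fin n → ℝ)
    (S : Fin n → TensorComp n k l) (c : Fin k → Fin n) (d : Fin l → Fin n) :
    frameComp B D (fun I J => ∑ a, v a * S a I J) c d = ∑ a, v a * frameComp B D (S a) c d := by
  simp only [frameComp, Finset.mul_sum]
  rw [Finset.sum_congr rfl fun J _ => Finset.sum_comm, Finset.sum_comm]
  exact Finset.sum_congr rfl fun a _ => Finset.sum_congr rfl fun J _ =>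
    Finset.sum_congr rfl fun I _ => by ring

theorem normSq_nonneg {G : Matrix (Fin n) (Fin n) ℝ} (hG : G.PosDef) (T : TensorComp n k l) :
    0 ≤ normSq G T := by
  obtain ⟨B, hB⟩ := exists_eq_transpose_mul_self hG
  obtain ⟨D, hD⟩ := exists_eq_transpose_mul_self hG.inv
  rw [normSq_eq_pairing, hD, hB, pairing_transpose_mul_self]
  exact Finset.sum_nonneg fun c _ => Finset.sum_nonneg fun d _ => mul_self_nonneg _

/-- The Cauchy–Schwarz inequality for the contraction of a tensor with a vector. -/
theorem sq_pairing_contract_le {G : Matrix (Fin n) (Fin n) ℝ} (hG : G.PosDef)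
    (v : Fin n → ℝ) (S : TensorComp n k (l + 1)) (T : TensorComp n k l) :
    pairing (prodMatrix G) (prodMatrix G⁻¹) (fun I J => ∑ a, v a * S I (Fin.cons a J)) T ^ 2 ≤
      (v ⬝ᵥ G *ᵥ v) * normSq G S * normSq G T := by
  obtain ⟨B, hB⟩ := exists_eq_transpose_mul_self hG
  have hdet : IsUnit B.det := by
    have h := hG.det_pos
    rw [hB, det_mul, det_transpose] at h
    exact isUnit_iff_ne_zero.2 fun h0 => by simp [h0] at h
  -- The rows of B form an orthonormal coframe and those of D its dual frame. Deriving D from B,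
  -- rather than from a separate root of G⁻¹, lets the contraction with v be computed in the frame.
  set D := (B⁻¹)ᵀ with hD
  have hinv : G⁻¹ = Dᵀ * D := by
    rw [hB, Matrix.mul_inv_rev, hD, transpose_transpose, transpose_nonsing_inv]
  set y := B *ᵥ v with hy
  have hvy : ∀ a, v a = ∑ e, y e * D e a := by
    intro a
    have : v = B⁻¹ *ᵥ y := by
      rw [hy, mulVec_mulVec, nonsing_inv_mul _ hdet, one_mulVec]
    conv_lhs => rw [this]
    simp only [mulVec, dotProduct, hD, transpose_apply]
    exact Finset.sum_congr rfl fun e _ => mul_comm _ _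
  have hyy : v ⬝ᵥ G *ᵥ v = ∑ e, y e ^ 2 := by
    rw [hB, ← mulVec_mulVec, dotProduct_mulVec, vecMul_transpose, ← hy]
    exact Finset.sum_congr rfl fun e _ => (sq _).symm
  rw [normSq_eq_pairing, normSq_eq_pairing, hinv, hyy, hB]
  simp only [pairing_transpose_mul_self, frameComp_sum B D v (fun a I J => S I (Fin.cons a J))]
  have hfr : ∀ c d, ∑ a, v a * frameComp B D (fun I J => S I (Fin.cons a J)) c d =
      ∑ e, y e * frameComp B D S c (Fin.cons e d) := by
    intro c d
    simp only [frameComp_cons, hvy, Finset.sum_mul, Finset.mul_sum]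
    rw [Finset.sum_comm]
    exact Finset.sum_congr rfl fun e _ => Finset.sum_congr rfl fun a _ => by ring
  simp only [hfr]
  -- One Cauchy–Schwarz over all triples (c, d, e), comparing y ⊗ T with S, gives the bound with
  -- constant one.
  have hcs := Finset.sum_mul_sq_le_sq_mul_sq
    (Finset.univ : Finset ((Fin k → Fin n) × (Fin l → Fin n) × Fin n))
    (fun q => y q.2.2 * frameComp B D T q.1 q.2.1)
    (fun q => frameComp B D S q.1 (Fin.cons q.2.2 q.2.1))
  simp only [Fintype.sum_prod_type] at hcs
  have e1 : ∑ c, ∑ d, (∑ e, y e * frameComp B D S c (Fin.cons e d)) * frameComp B D T c d =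
      ∑ c, ∑ d, ∑ e, y e * frameComp B D T c d * frameComp B D S c (Fin.cons e d) := by
    simp only [Finset.sum_mul]
    exact Finset.sum_congr rfl fun c _ => Finset.sum_congr rfl fun d _ =>
      Finset.sum_congr rfl fun e _ => by ring
  have e2 : ∑ c, ∑ d, ∑ e, (y e * frameComp B D T c d) ^ 2 =
      (∑ e, y e ^ 2) * ∑ c, ∑ d, frameComp B D T c d * frameComp B D T c d := by
    simp only [Finset.mul_sum, Finset.sum_mul]
    exact Finset.sum_congr rfl fun c _ => Finset.sum_congr rfl fun d _ =>
      Finset.sum_congr rfl fun e _ => by ring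
  have e3 : ∑ c, ∑ d, ∑ e, frameComp B D S c (Fin.cons e d) ^ 2 =
      ∑ c, ∑ d, frameComp B D S c d * frameComp B D S c d := by
    refine Finset.sum_congr rfl fun c _ => ?_
    rw [sum_fin_cons, Finset.sum_comm]
    exact Finset.sum_congr rfl fun d _ => Finset.sum_congr rfl fun e _ => by ring
  rw [e1]
  refine hcs.trans_eq ?_
  rw [e2, e3]
  ring

end Frames

/-! ### Metric compatibility of the Levi-Civita connection. -/

section Metric

open Matrix

variable {n k l : ℕ}

theorem contDiffAt_det {N : ℕ∞ω} {g : Euc n → Matrix (Fin n) (Fin n) ℝ} {p : Euc n}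
    (hg : ∀ i j, ContDiffAt ℝ N (fun q => g q i j) p) : ContDiffAt ℝ N (fun q => (g q).det) p := by
  simp only [Matrix.det_apply]
  exact ContDiffAt.sum fun τ _ => (contDiffAt_prod fun i _ => hg _ _).const_smul _

theorem contDiffAt_inv {N : ℕ∞ω} {g : Euc n → Matrix (Fin n) (Fin n) ℝ} {p : Euc n}
    (hg : ∀ i j, ContDiffAt ℝ N (fun q => g q i j) p) (hdet : (g p).det ≠ 0) (i j : Fin n) :
    ContDiffAt ℝ N (fun q => (g q)⁻¹ i j) p := by
  simp only [Matrix.inv_def, Ring.inverse_eq_inv', Matrix.smul_apply, smul_eq_mul,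
    Matrix.adjugate_apply]
  refine ((contDiffAt_det hg).inv hdet).mul (contDiffAt_det fun a b => ?_)
  by_cases h : a = j
  · subst h
    simpa using contDiffAt_const
  · simpa [Matrix.updateRow_ne h] using hg a b

theorem contDiffAt_normSq {N : ℕ∞ω} {g : Euc n → Matrix (Fin n) (Fin n) ℝ} {p : Euc n}
    (hg : ∀ i j, ContDiffAt ℝ N (fun q => g q i j) p) (hdet : (g p).det ≠ 0)
    {T : Euc n → TensorComp n k l} (hT : ∀ I J, ContDiffAt ℝ N (fun q => T q I J) p) :
    ContDiffAt ℝ N (fun q => normSq (g q) (T q)) p := by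
  unfold normSq
  exact ContDiffAt.sum fun I _ => ContDiffAt.sum fun I' _ => ContDiffAt.sum fun J _ =>
    ContDiffAt.sum fun J' _ => (((contDiffAt_prod fun s _ => hg _ _).mul
      (contDiffAt_prod fun s _ => contDiffAt_inv hg hdet _ _)).mul (hT _ _)).mul (hT _ _)

theorem continuousAt_partialD {f : Euc n → ℝ} {p : Euc n} (hf : ContDiffAt ℝ 1 f p) (a : Fin n) :
    ContinuousAt (partialD f a) p :=
  (hf.continuousAt_fderiv (by simp)).clm_apply continuousAt_const

theorem continuousAt_covDeriv {g : Euc n → Matrix (Fin n) (Fin n) ℝ} {p : Euc n}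
    (hg : ∀ i j, ContDiffAt ℝ 1 (fun q => g q i j) p) (hdet : (g p).det ≠ 0)
    {u : Euc n → TensorComp n k l} (hu : ∀ I J, ContDiffAt ℝ 1 (fun q => u q I J) p)
    (I : Fin k → Fin n) (J : Fin (l + 1) → Fin n) :
    ContinuousAt (fun q => covDeriv g u q I J) p := by
  have hch : ∀ m a b, ContinuousAt (fun q => christoffel g q m a b) p := by
    intro m a b
    unfold christoffel
    refine continuousAt_const.mul (tendsto_finsetSum _ fun c _ => ?_)
    exact (contDiffAt_inv hg hdet _ _).continuousAt.mul
      (((continuousAt_partialD (hg _ _) _).add (continuousAt_partialD (hg _ _) _)).sub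
        (continuousAt_partialD (hg _ _) _))
  unfold covDeriv
  refine ((continuousAt_partialD (hu _ _) _).add ?_).sub ?_
  · exact tendsto_finsetSum _ fun s _ => tendsto_finsetSum _ fun m _ =>
      (hch _ _ _).mul (hu _ _).continuousAt
  · exact tendsto_finsetSum _ fun s _ => tendsto_finsetSum _ fun m _ =>
      (hch _ _ _).mul (hu _ _).continuousAt

theorem continuousAt_normSq_covDeriv {g : Euc n → Matrix (Fin n) (Fin n) ℝ} {p : Euc n}
    (hg : ∀ i j, ContDiffAt ℝ 1 (fun q => g q i j) p) (hdet : (g p).det ≠ 0)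
    {u : Euc n → TensorComp n k l} (hu : ∀ I J, ContDiffAt ℝ 1 (fun q => u q I J) p) :
    ContinuousAt (fun q => normSq (g q) (covDeriv g u q)) p := by
  unfold normSq
  exact tendsto_finsetSum _ fun I _ => tendsto_finsetSum _ fun I' _ => tendsto_finsetSum _ fun J _ =>
    tendsto_finsetSum _ fun J' _ => (((tendsto_finsetProd _ fun s _ => (hg _ _).continuousAt).mul
      (tendsto_finsetProd _ fun s _ => (contDiffAt_inv hg hdet _ _).continuousAt)).mul
        (continuousAt_covDeriv hg hdet hu _ _)).mul (continuousAt_covDeriv hg hdet hu _ _)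

theorem hasDerivAt_partialD {f : Euc n → ℝ} {p : Euc n} (hf : DifferentiableAt ℝ f p)
    (a : Fin n) : HasDerivAt (fun t : ℝ => f (p + t • EuclideanSpace.single a 1))
      (partialD f a p) 0 :=
  hf.hasFDerivAt.hasLineDerivAt _

theorem partialD_metric {g : Euc n → Matrix (Fin n) (Fin n) ℝ} {p : Euc n}
    (hdet : IsUnit (g p).det) (hs : ∀ᶠ q in 𝓝 p, (g q).IsSymm) (a i j : Fin n) :
    partialD (fun q => g q i j) a p =
      ∑ m, (g p m j * christoffel g p m a i + g p m i * christoffel g p m a j) := by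
  have hsym : ∀ b i j, partialD (fun q => g q i j) b p = partialD (fun q => g q j i) b p := by
    intro b i j
    unfold partialD
    have : (fun q => g q i j) =ᶠ[𝓝 p] fun q => g q j i := hs.mono fun q hq => hq.apply _ _
    rw [this.fderiv_eq]
  have hps : (g p).IsSymm := hs.self_of_nhds
  -- Contraction with g cancels the inverse matrix. Adding the same formula with i and j exchanged,
  -- all but ∂_a g cancels by symmetry.
  have key : ∀ i j, ∑ m, g p m j * christoffel g p m a i = (1 / 2) *
      (partialD (fun q => g q j i) a p + partialD (fun q => g q j a) i p
        - partialD (fun q => g q a i) j p) := by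
    intro i j
    set X : Fin n → ℝ := fun c => partialD (fun q => g q c i) a p
      + partialD (fun q => g q c a) i p - partialD (fun q => g q a i) c p with hX
    have h1 : ∀ m, christoffel g p m a i = (1 / 2) * ((g p)⁻¹ *ᵥ X) m := fun m => rfl
    have h2 : ∑ m, g p m j * ((g p)⁻¹ *ᵥ X) m = (g p *ᵥ ((g p)⁻¹ *ᵥ X)) j := by
      simp only [mulVec, dotProduct]
      exact Finset.sum_congr rfl fun m _ => by rw [hps.apply]
    rw [mulVec_mulVec, mul_nonsing_inv _ hdet, one_mulVec] at h2
    simp only [h1]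
    refine Eq.trans ?_ (congrArg (fun z => 1 / 2 * z) h2)
    rw [Finset.mul_sum]
    exact Finset.sum_congr rfl fun m _ => by ring
  rw [Finset.sum_add_distrib, key, key, hsym a j i, hsym i j a, hsym j a i, hsym i a j]
  ring

/-- Differentiating g g⁻¹ = 1 shows that the inverse metric varies through -Mᵀ when g varies through
M, which is the sign and transposition of the lower-index terms of the covariant derivative. -/
theorem partialD_inv {g : Euc n → Matrix (Fin n) (Fin n) ℝ} {p : Euc n}
    (hg : ∀ i j, ContDiffAt ℝ 1 (fun q => g q i j) p) (hdet : (g p).det ≠ 0)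
    {M : Matrix (Fin n) (Fin n) ℝ} {a : Fin n} (hs : (g p).IsSymm)
    (hM : ∀ i j, partialD (fun q => g q i j) a p = ∑ m, (g p m j * M m i + g p m i * M m j))
    (i j : Fin n) : partialD (fun q => (g q)⁻¹ i j) a p =
      ∑ m, ((g p)⁻¹ m j * (-Mᵀ) m i + (g p)⁻¹ m i * (-Mᵀ) m j) := by
  set H : Matrix (Fin n) (Fin n) ℝ := (g p)⁻¹ with hH
  set dH : Matrix (Fin n) (Fin n) ℝ := of fun i j => partialD (fun q => (g q)⁻¹ i j) a p with hdH
  set dG : Matrix (Fin n) (Fin n) ℝ := of fun i j => partialD (fun q => g q i j) a p with hdG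
  have hu : IsUnit (g p).det := isUnit_iff_ne_zero.2 hdet
  have hdG' : dG = g p * M + Mᵀ * g p := by
    ext i j
    simp only [hdG, of_apply, hM, Matrix.add_apply, Matrix.mul_apply, transpose_apply,
      ← Finset.sum_add_distrib]
    exact Finset.sum_congr rfl fun m _ => by rw [hs.apply i m]; ring
  have hprod : g p * dH + dG * H = 0 := by
    ext i j
    have h1 : HasDerivAt (fun t : ℝ => ∑ m, g (p + t • EuclideanSpace.single a 1) i m *
        (g (p + t • EuclideanSpace.single a 1))⁻¹ m j)
        (∑ m, (dG i m * (g p)⁻¹ m j + g p i m * dH m j)) 0 := by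
      refine HasDerivAt.fun_sum fun m _ => ?_
      have := (hasDerivAt_partialD ((hg i m).differentiableAt (by simp)) a).fun_mul
        (hasDerivAt_partialD ((contDiffAt_inv hg hdet m j).differentiableAt (by simp)) a)
      simpa [hdG, hdH] using this
    have h2 : (fun t : ℝ => ∑ m, g (p + t • EuclideanSpace.single a 1) i m *
        (g (p + t • EuclideanSpace.single a 1))⁻¹ m j) =ᶠ[𝓝 0]
        fun _ => (1 : Matrix (Fin n) (Fin n) ℝ) i j := by
      have hc : ContinuousAt (fun t : ℝ => (g (p + t • EuclideanSpace.single a 1)).det) 0 := by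
        refine ContinuousAt.comp (g := fun q => (g q).det) ?_ (by fun_prop)
        simpa using (contDiffAt_det hg).continuousAt
      filter_upwards [hc.eventually_ne (by simpa using hdet)] with t ht
      rw [← Matrix.mul_apply, mul_nonsing_inv _ (isUnit_iff_ne_zero.2 ht)]
    have h3 := h1.unique ((hasDerivAt_const (0 : ℝ) _).congr_of_eventuallyEq h2)
    rw [Finset.sum_add_distrib] at h3
    simp only [Matrix.add_apply, Matrix.mul_apply, Matrix.zero_apply]
    rw [add_comm]
    exact h3
  have hfin : dH = -(M * H) - H * Mᵀ := by
    have h1 : g p * dH = -(dG * H) := eq_neg_of_add_eq_zero_left hprod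
    calc dH = H * (g p * dH) := by rw [← Matrix.mul_assoc, hH, nonsing_inv_mul _ hu, Matrix.one_mul]
      _ = -((H * g p) * M * H) - H * Mᵀ * (g p * H) := by
        rw [h1, hdG']; noncomm_ring
      _ = _ := by
        rw [hH, nonsing_inv_mul _ hu, mul_nonsing_inv _ hu, Matrix.one_mul, Matrix.mul_one]
  have hHs : H.IsSymm := by
    rw [IsSymm, hH, transpose_nonsing_inv, hs.eq]
  have : dH i j = (-(M * H) - H * Mᵀ) i j := by rw [hfin]
  simp only [hdH, of_apply, Matrix.sub_apply, Matrix.neg_apply, Matrix.mul_apply,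
    transpose_apply] at this
  rw [this, Finset.sum_add_distrib, sub_eq_add_neg, ← Finset.sum_neg_distrib,
    ← Finset.sum_neg_distrib]
  congr 1 <;> refine Finset.sum_congr rfl fun m _ => ?_
  · simp; ring
  · rw [hHs.apply]; simp

/-- **Metric compatibility** of the Levi-Civita connection. -/
theorem partialD_normSq {g : Euc n → Matrix (Fin n) (Fin n) ℝ} {p : Euc n}
    (hg : ∀ i j, ContDiffAt ℝ 1 (fun q => g q i j) p) (hdet : (g p).det ≠ 0)
    (hs : ∀ᶠ q in 𝓝 p, (g q).IsSymm)
    {u : Euc n → TensorComp n k l} (hu : ∀ I J, ContDiffAt ℝ 1 (fun q => u q I J) p) (a : Fin n) :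
    partialD (fun q => normSq (g q) (u q)) a p =
      2 * pairing (prodMatrix (g p)) (prodMatrix (g p)⁻¹)
        (fun I J => covDeriv g u p I (Fin.cons a J)) (u p) := by
  have hps : (g p).IsSymm := hs.self_of_nhds
  -- With this M, the actions of M on upper and of -Mᵀ on lower indices are exactly the Christoffel
  -- terms in `covDeriv`.
  set M : Matrix (Fin n) (Fin n) ℝ := of fun m b => christoffel g p m a b with hM
  have hG : ∀ i j, partialD (fun q => g q i j) a p =
      ∑ m, (g p m j * M m i + g p m i * M m j) :=
    partialD_metric (isUnit_iff_ne_zero.2 hdet) hs a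
  have hd : DifferentiableAt ℝ (fun q => normSq (g q) (u q)) p :=
    (contDiffAt_normSq hg hdet hu).differentiableAt (by simp)
  have h1 := hasDerivAt_partialD hd a
  have h2 := hasDerivAt_pairing (t := 0) (M := M) (k := k) (l := l)
    (G := fun t : ℝ => g (p + t • EuclideanSpace.single a 1))
    (H := fun t : ℝ => (g (p + t • EuclideanSpace.single a 1))⁻¹)
    (T := fun t : ℝ => u (p + t • EuclideanSpace.single a 1))
    (S := fun I J => partialD (fun q => u q I J) a p)
    (fun i j => by
      simpa [hG] using hasDerivAt_partialD ((hg i j).differentiableAt (by simp)) a)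
    (by simpa using hps)
    (fun i j => by
      simpa [partialD_inv hg hdet hps hG] using
        hasDerivAt_partialD ((contDiffAt_inv hg hdet i j).differentiableAt (by simp)) a)
    (by simp [IsSymm, transpose_nonsing_inv, hps.eq])
    (fun I J => hasDerivAt_partialD ((hu I J).differentiableAt (by simp)) a)
  simp only [normSq_eq_pairing] at h1 ⊢
  rw [h1.unique h2]
  simp only [zero_smul, add_zero]
  congr 2
  ext I J
  simp [covDeriv, derivAction, hM, sub_eq_add_neg, Fin.tail_cons]

theorem fderiv_eq_sum_partialD (f : Euc n → ℝ) (p v : Euc n) :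
    fderiv ℝ f p v = ∑ a, v a * partialD f a p := by
  have hv : v = ∑ a, v a • EuclideanSpace.single a (1 : ℝ) := by
    ext i
    simp [Pi.single_apply]
  conv_lhs => rw [hv]
  rw [map_sum]
  exact Finset.sum_congr rfl fun a _ => by rw [map_smul, smul_eq_mul, partialD]

/-- The only passage from derivatives of |u|² to ∇u. By metric compatibility all derivatives of g
are contained in ∇u, hence the bound involves g only through its values. -/
theorem sq_fderiv_normSq_le {g : Euc n → Matrix (Fin n) (Fin n) ℝ} {p : Euc n}
    (hg : ∀ i j, ContDiffAt ℝ 1 (fun q => g q i j) p) (hpos : ∀ᶠ q in 𝓝 p, (g q).PosDef)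
    {u : Euc n → TensorComp n k l} (hu : ∀ I J, ContDiffAt ℝ 1 (fun q => u q I J) p) (v : Euc n) :
    (fderiv ℝ (fun q => normSq (g q) (u q)) p v) ^ 2 ≤
      4 * (⇑v ⬝ᵥ g p *ᵥ ⇑v) * normSq (g p) (u p) * normSq (g p) (covDeriv g u p) := by
  have hp : (g p).PosDef := hpos.self_of_nhds
  have hs : ∀ᶠ q in 𝓝 p, (g q).IsSymm := hpos.mono fun q hq => by
    have := hq.1
    rwa [IsHermitian, conjTranspose_eq_transpose_of_trivial] at this
  have h1 : fderiv ℝ (fun q => normSq (g q) (u q)) p v =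
      2 * pairing (prodMatrix (g p)) (prodMatrix (g p)⁻¹)
        (fun I J => ∑ a, v a * covDeriv g u p I (Fin.cons a J)) (u p) := by
    rw [fderiv_eq_sum_partialD]
    have h2 : ∀ s : Finset (Fin n), pairing (prodMatrix (g p)) (prodMatrix (g p)⁻¹)
        (fun I J => ∑ a ∈ s, v a * covDeriv g u p I (Fin.cons a J)) (u p) =
        ∑ a ∈ s, v a * pairing (prodMatrix (g p)) (prodMatrix (g p)⁻¹)
          (fun I J => covDeriv g u p I (Fin.cons a J)) (u p) := by
      intro s
      induction s using Finset.induction_on with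
      | empty => simp [pairing]
      | insert a s ha ih =>
        simp only [Finset.sum_insert ha, ← ih]
        rw [← pairing_smul_left, ← pairing_add_left]
        rfl
    rw [h2, Finset.mul_sum]
    refine Finset.sum_congr rfl fun a _ => ?_
    rw [partialD_normSq hg hp.det_pos.ne' hs hu]
    ring
  have h3 := sq_pairing_contract_le hp v (covDeriv g u p) (u p)
  rw [h1, mul_pow]
  linarith

end Metric

/-! ### Uniform comparison of g with the Euclidean metric. -/

section MetricBounds

open Matrix

variable {n : ℕ} {Ω : Set (Euc n)}

/-- The limit controls h outside a large ball, compactness of the closure inside it controls the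
rest. -/
theorem exists_bound_of_tendsto {h : Euc n → ℝ} {L : ℝ} (hc : ContinuousOn h (closure Ω))
    (hL : Tendsto h (Bornology.cobounded (Euc n) ⊓ 𝓟 Ω) (𝓝 L)) :
    ∃ M : ℝ, ∀ p ∈ Ω, |h p| ≤ M := by
  have h1 : ∀ᶠ p in Bornology.cobounded (Euc n) ⊓ 𝓟 Ω, |h p| < |L| + 1 :=
    hL.abs.eventually_lt_const (lt_add_one _)
  rw [eventually_inf_principal, ← comap_norm_atTop, eventually_comap] at h1
  obtain ⟨ρ, hρ⟩ := eventually_atTop.1 h1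
  have hK : IsCompact (closure Ω ∩ Metric.closedBall 0 ρ) :=
    (isCompact_closedBall 0 ρ).inter_left isClosed_closure
  obtain ⟨M, hM⟩ := hK.exists_bound_of_continuousOn (hc.mono inter_subset_left)
  refine ⟨max M (|L| + 1), fun p hp => ?_⟩
  rcases le_or_gt ‖p‖ ρ with hpρ | hpρ
  · exact (hM p ⟨subset_closure hp, by simpa using hpρ⟩).trans (le_max_left _ _)
  · exact (hρ ‖p‖ hpρ.le p rfl hp).le.trans (le_max_right _ _)

theorem exists_pos_le_of_tendsto {h : Euc n → ℝ} {L : ℝ} (hc : ContinuousOn h (closure Ω))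
    (hL : Tendsto h (Bornology.cobounded (Euc n) ⊓ 𝓟 Ω) (𝓝 L)) (hpos : ∀ p ∈ closure Ω, 0 < h p)
    (hL0 : 0 < L) : ∃ m : ℝ, 0 < m ∧ ∀ p ∈ Ω, m ≤ h p := by
  obtain ⟨M, hM⟩ := exists_bound_of_tendsto (hc.inv₀ fun p hp => (hpos p hp).ne')
    (hL.inv₀ hL0.ne')
  refine ⟨(max M 1)⁻¹, by positivity, fun p hp => ?_⟩
  have h0 := hpos p (subset_closure hp)
  have h1 : (h p)⁻¹ ≤ max M 1 := (le_abs_self _).trans ((hM p hp).trans (le_max_left _ _))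
  exact inv_le_of_inv_le₀ h0 h1

/-- An asymptotically Euclidean metric is uniformly comparable with the Euclidean one. -/
theorem IsAsymptoticallyEuclideanMetric.exists_bounds {g : Euc n → Matrix (Fin n) (Fin n) ℝ}
    (hg : IsAsymptoticallyEuclideanMetric Ω g) :
    ∃ m M : ℝ, 0 < m ∧ 0 < M ∧ ∀ p ∈ Ω, m ≤ √(g p).det ∧ √(g p).det ≤ M ∧
      ∀ v : Euc n, ⇑v ⬝ᵥ g p *ᵥ ⇑v ≤ M * ‖v‖ ^ 2 := by
  have hdc : ContinuousOn (fun p => √(g p).det) (closure Ω) := by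
    simp only [Matrix.det_apply]
    refine (continuousOn_finsetSum _ fun τ _ => ?_).sqrt
    exact (continuousOn_finsetProd _ fun i _ => hg.continuousOn _ _).const_smul _
  have hdl : Tendsto (fun p => √(g p).det) (Bornology.cobounded (Euc n) ⊓ 𝓟 Ω) (𝓝 1) := by
    have h1 : √(1 : Matrix (Fin n) (Fin n) ℝ).det = 1 := by simp
    rw [← h1]
    simp only [Matrix.det_apply]
    refine (tendsto_finsetSum _ fun τ _ => ?_).sqrt
    exact (tendsto_finsetProd _ fun i _ => hg.tendsto _ _).const_smul _
  obtain ⟨m, hm, hmd⟩ := exists_pos_le_of_tendsto hdc hdl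
    (fun p hp => Real.sqrt_pos.2 (hg.posDef p hp).det_pos) one_pos
  obtain ⟨M, hM⟩ := exists_bound_of_tendsto hdc hdl
  choose A hA using fun i j => exists_bound_of_tendsto (hg.continuousOn i j) (hg.tendsto i j)
  set B := ∑ i, ∑ j, |A i j| with hB
  have hB0 : 0 ≤ B := Finset.sum_nonneg fun i _ => Finset.sum_nonneg fun j _ => abs_nonneg _
  refine ⟨m, max M B + 1, hm, by positivity, fun p hp => ⟨hmd p hp, ?_, fun v => ?_⟩⟩
  · have := (le_abs_self _).trans (hM p hp)
    linarith [le_max_left M B]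
  · have h1 : ⇑v ⬝ᵥ g p *ᵥ ⇑v ≤ ∑ i, ∑ j, |A i j| * ‖v‖ ^ 2 := by
      simp only [dotProduct, mulVec, Finset.mul_sum]
      refine Finset.sum_le_sum fun i _ => Finset.sum_le_sum fun j _ => ?_
      refine (le_abs_self _).trans ?_
      rw [abs_mul, abs_mul]
      have hi : |v i| ≤ ‖v‖ := PiLp.norm_apply_le v i
      have hj : |v j| ≤ ‖v‖ := PiLp.norm_apply_le v j
      have ha : |g p i j| ≤ |A i j| := (hA i j p hp).trans (le_abs_self _)
      calc |v i| * (|g p i j| * |v j|) ≤ ‖v‖ * (|A i j| * ‖v‖) := by gcongr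
        _ = _ := by ring
    simp only [← Finset.sum_mul, ← hB] at h1
    refine h1.trans ?_
    gcongr
    linarith [le_max_right M B]

end MetricBounds

/-! ### The vector field and its Euclidean divergence. -/

section VectorField

open Gradient

variable {n : ℕ} {Ω : Set (Euc n)} {R₀ : ℝ} {x r : Euc n → ℝ}

theorem gradient_apply (f : Euc n → ℝ) (p : Euc n) (i : Fin n) : (∇ f p) i = partialD f i p := by
  have h : inner ℝ (∇ f p) (EuclideanSpace.single i 1) = partialD f i p := by
    rw [gradient, InnerProductSpace.toDual_symm_apply, partialD]
  rw [← h, EuclideanSpace.inner_single_right]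
  simp

theorem norm_gradient_eq (f : Euc n → ℝ) (p : Euc n) : ‖∇ f p‖ = ‖fderiv ℝ f p‖ :=
  LinearIsometryEquiv.norm_map _ _

theorem sum_partialD_sq (f : Euc n → ℝ) (p : Euc n) :
    ∑ i, partialD f i p ^ 2 = ‖fderiv ℝ f p‖ ^ 2 := by
  rw [← norm_gradient_eq, EuclideanSpace.real_norm_sq_eq]
  simp only [gradient_apply]

theorem abs_sum_partialD_mul_le (f h : Euc n → ℝ) (p : Euc n) :
    |∑ i, partialD f i p * partialD h i p| ≤ ‖fderiv ℝ f p‖ * ‖fderiv ℝ h p‖ := by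
  have h1 : ∑ i, partialD f i p * partialD h i p = fderiv ℝ f p (∇ h p) := by
    rw [fderiv_eq_sum_partialD]
    exact Finset.sum_congr rfl fun i _ => by rw [gradient_apply, mul_comm]
  rw [h1, ← norm_gradient_eq h, ← Real.norm_eq_abs]
  exact ContinuousLinearMap.le_opNorm _ _

theorem partialD_partialD {f : Euc n → ℝ} {p : Euc n} (hf : ContDiffAt ℝ 2 f p) (i : Fin n) :
    partialD (partialD f i) i p =
      fderiv ℝ (fderiv ℝ f) p (EuclideanSpace.single i 1) (EuclideanSpace.single i 1) := by
  have h1 : DifferentiableAt ℝ (fderiv ℝ f) p :=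
    (hf.fderiv_right (m := 1) (by norm_num)).differentiableAt (by simp)
  unfold partialD
  rw [fderiv_clm_apply h1 (differentiableAt_const _)]
  simp

theorem abs_sum_partialD_partialD_le {f : Euc n → ℝ} {p : Euc n} (hf : ContDiffAt ℝ 2 f p) :
    |∑ i, partialD (partialD f i) i p| ≤ n * ‖fderiv ℝ (fderiv ℝ f) p‖ := by
  refine (Finset.abs_sum_le_sum_abs _ _).trans ?_
  have : ∀ i : Fin n, |partialD (partialD f i) i p| ≤ ‖fderiv ℝ (fderiv ℝ f) p‖ := by
    intro i
    rw [partialD_partialD hf]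
    have := ContinuousLinearMap.le_opNorm₂ (fderiv ℝ (fderiv ℝ f) p)
      (EuclideanSpace.single i (1 : ℝ)) (EuclideanSpace.single i (1 : ℝ))
    simpa using this
  refine (Finset.sum_le_sum fun i _ => this i).trans_eq ?_
  simp

theorem contDiffAt_partialD {f : Euc n → ℝ} {p : Euc n} (hf : ContDiffAt ℝ 2 f p) (i : Fin n) :
    ContDiffAt ℝ 1 (partialD f i) p :=
  (hf.fderiv_right (m := 1) (by norm_num)).clm_apply contDiffAt_const

/-- The vector field `x ^ (a + 1) (s r ^ b ∇x + κ χ r ^ (b - 1) p)`. -/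
noncomputable def hardyField (x r χ : Euc n → ℝ) (a b s κ : ℝ) (p : Euc n) : Euc n :=
  x p ^ (a + 1) • ((s * r p ^ b) • ∇ x p + (κ * χ p * r p ^ (b - 1)) • p)

theorem hardyField_apply (x r χ : Euc n → ℝ) (a b s κ : ℝ) (p : Euc n) (i : Fin n) :
    hardyField x r χ a b s κ p i =
      x p ^ (a + 1) * (s * r p ^ b * partialD x i p + κ * χ p * r p ^ (b - 1) * p i) := by
  simp [hardyField, gradient_apply, mul_add]

theorem contDiffAt_coord (p : Euc n) (i : Fin n) {N : ℕ∞ω} :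
    ContDiffAt ℝ N (fun q : Euc n => q i) p :=
  (EuclideanSpace.proj i : Euc n →L[ℝ] ℝ).contDiff.contDiffAt

variable {χ : Euc n → ℝ} {p : Euc n} {a b s κ : ℝ}

theorem contDiffAt_hardyField (hx : ContDiffAt ℝ 2 x p) (hr : ContDiffAt ℝ 2 r p)
    (hχ : ContDiffAt ℝ 2 χ p) (hx0 : 0 < x p) (hr0 : 0 < r p) (i : Fin n) :
    ContDiffAt ℝ 1 (fun q => hardyField x r χ a b s κ q i) p := by
  have h12 : (1 : ℕ∞ω) ≤ 2 := by norm_num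
  simp only [hardyField_apply]
  have hrr := fun c => (hr.of_le h12).rpow_const_of_ne (p := c) hr0.ne'
  exact ((hx.of_le h12).rpow_const_of_ne hx0.ne').mul
    (((contDiffAt_const.mul (hrr _)).mul (contDiffAt_partialD hx i)).add
      (((contDiffAt_const.mul (hχ.of_le h12)).mul (hrr _)).mul (contDiffAt_coord p i)))

theorem partialD_hardyField (hx : ContDiffAt ℝ 2 x p) (hr : ContDiffAt ℝ 2 r p)
    (hχ : ContDiffAt ℝ 2 χ p) (hx0 : 0 < x p) (hr0 : 0 < r p) (i : Fin n) :
    partialD (fun q => hardyField x r χ a b s κ q i) i p =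
      x p ^ a * r p ^ b * (s * ((a + 1) * partialD x i p ^ 2
          + x p / r p * (b * (partialD r i p * partialD x i p)
            + r p * partialD (partialD x i) i p))
        + κ * (x p / r p * (p i * partialD χ i p) + χ p * ((a + 1) / r p * (p i * partialD x i p)
          + (b - 1) * (x p / r p) / r p * (p i * partialD r i p) + x p / r p))) := by
  have d : ∀ {f : Euc n → ℝ}, ContDiffAt ℝ 2 f p →
      HasDerivAt (fun t : ℝ => f (p + t • EuclideanSpace.single i 1)) (partialD f i p) 0 :=
    fun hf => hasDerivAt_partialD (hf.differentiableAt (by simp)) i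
  have hV : HasDerivAt
      (fun t : ℝ => hardyField x r χ a b s κ (p + t • EuclideanSpace.single i 1) i)
      (partialD (fun q => hardyField x r χ a b s κ q i) i p) 0 :=
    hasDerivAt_partialD (f := fun q => hardyField x r χ a b s κ q i)
      ((contDiffAt_hardyField hx hr hχ hx0 hr0 i).differentiableAt (by simp)) i
  have hX := hasDerivAt_partialD ((contDiffAt_partialD hx i).differentiableAt (by simp)) i
  have hi : HasDerivAt (fun t : ℝ => (p + t • EuclideanSpace.single i (1 : ℝ)) i) 1 0 := by
    simpa using (hasDerivAt_id (0 : ℝ)).const_add (p i)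
  have e0 : p + (0 : ℝ) • EuclideanSpace.single i (1 : ℝ) = p := by simp
  have hxa := (d hx).rpow_const (p := a + 1) (Or.inl (by rw [e0]; exact hx0.ne'))
  have hrb := (d hr).rpow_const (p := b) (Or.inl (by rw [e0]; exact hr0.ne'))
  have hrb1 := (d hr).rpow_const (p := b - 1) (Or.inl (by rw [e0]; exact hr0.ne'))
  have h := hxa.fun_mul (((hrb.const_mul s).fun_mul hX).fun_add
    ((((d hχ).const_mul κ).fun_mul hrb1).fun_mul hi))
  simp only [hardyField_apply] at hV ⊢
  rw [hV.unique h]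
  simp only [e0]
  have ex : x p ^ (a + 1) = x p ^ a * x p := by rw [Real.rpow_add hx0, Real.rpow_one]
  have er : r p ^ (b - 1) = r p ^ b / r p := by rw [Real.rpow_sub hr0, Real.rpow_one]
  have er2 : r p ^ (b - 1 - 1) = r p ^ b / r p / r p := by
    rw [Real.rpow_sub hr0, Real.rpow_sub hr0, Real.rpow_one]
  rw [add_sub_cancel_right, ex, er, er2]
  field_simp
  ring

/-- Factoring out x^a r^b leaves scale invariant quantities, and the summand along p shows only
radial derivatives, ready for Euler's identities. -/
theorem div_hardyField (hx : ContDiffAt ℝ 2 x p) (hr : ContDiffAt ℝ 2 r p)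
    (hχ : ContDiffAt ℝ 2 χ p) (hx0 : 0 < x p) (hr0 : 0 < r p) :
    ∑ i, partialD (fun q => hardyField x r χ a b s κ q i) i p =
      x p ^ a * r p ^ b * (s * ((a + 1) * ‖fderiv ℝ x p‖ ^ 2
          + x p / r p * (b * (∑ i, partialD r i p * partialD x i p)
            + r p * ∑ i, partialD (partialD x i) i p))
        + κ * (x p / r p * fderiv ℝ χ p p + χ p * ((a + 1) / r p * fderiv ℝ x p p
          + (b - 1) * (x p / r p) / r p * fderiv ℝ r p p + n * (x p / r p)))) := by
  simp only [partialD_hardyField hx hr hχ hx0 hr0, fderiv_eq_sum_partialD _ p p,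
    ← sum_partialD_sq]
  rw [← Finset.mul_sum]
  simp only [Finset.sum_add_distrib, ← Finset.mul_sum, Finset.sum_const, Finset.card_univ,
    Fintype.card_fin, nsmul_eq_mul]

end VectorField

/-! ### Choice of constants and lower bound for the divergence. -/

section HardyEstimate

variable {n : ℕ} {Ω : Set (Euc n)} {R₀ : ℝ} {x r : Euc n → ℝ}

/-- A smooth cutoff function vanishing for `‖p‖ ≤ 2 R₀`, equal to one for `2 R₀ + 1 ≤ ‖p‖`. -/
noncomputable def radialCutoff (R₀ : ℝ) (p : Euc n) : ℝ :=
  Real.smoothTransition (‖p‖ ^ 2 - (2 * R₀) ^ 2)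

theorem contDiff_radialCutoff {N : ℕ∞} : ContDiff ℝ N (radialCutoff R₀ : Euc n → ℝ) :=
  Real.smoothTransition.contDiff.comp ((contDiff_norm_sq ℝ).sub contDiff_const)

theorem radialCutoff_mem (p : Euc n) : 0 ≤ radialCutoff R₀ p ∧ radialCutoff R₀ p ≤ 1 :=
  ⟨Real.smoothTransition.nonneg _, Real.smoothTransition.le_one _⟩

theorem lt_norm_of_radialCutoff_ne_zero (h0 : 0 ≤ R₀) {p : Euc n} (h : radialCutoff R₀ p ≠ 0) :
    2 * R₀ < ‖p‖ := by
  by_contra! hp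
  exact h (Real.smoothTransition.zero_of_nonpos (by nlinarith [norm_nonneg p]))

/-- Here (2R₀+1)² - (2R₀)² = 4R₀ + 1 ≥ 1. -/
theorem radialCutoff_eq_one (h0 : 0 ≤ R₀) {p : Euc n} (h : 2 * R₀ + 1 ≤ ‖p‖) :
    radialCutoff R₀ p = 1 :=
  Real.smoothTransition.one_of_one_le (by nlinarith)

theorem fderiv_radialCutoff_eq_zero (h0 : 0 ≤ R₀) {p : Euc n} (h : 2 * R₀ + 1 < ‖p‖) :
    fderiv ℝ (radialCutoff R₀) p = 0 := by
  have : radialCutoff R₀ =ᶠ[𝓝 p] fun _ => (1 : ℝ) := by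
    filter_upwards [continuous_norm.continuousAt.eventually_const_lt h] with q hq
    exact radialCutoff_eq_one h0 hq.le
  rw [this.fderiv_eq (𝕜 := ℝ)]
  simp

theorem exists_bound_fderiv_radialCutoff (n : ℕ) (R₀ ρ : ℝ) :
    ∃ M : ℝ, 0 ≤ M ∧ ∀ p : Euc n, ‖p‖ ≤ ρ → |fderiv ℝ (radialCutoff R₀) p p| ≤ M := by
  have hc : Continuous fun p : Euc n => fderiv ℝ (radialCutoff R₀) p p :=
    ((contDiff_radialCutoff (N := 1)).continuous_fderiv (by simp)).clm_apply continuous_id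
  obtain ⟨M, hM⟩ := (isCompact_closedBall (0 : Euc n) ρ).exists_bound_of_continuousOn
    hc.continuousOn
  refine ⟨max M 0, le_max_right _ _, fun p hp => (hM p (by simpa using hp)).trans (le_max_left _ _)⟩

theorem exists_rpow_le (c : ℝ) {u v : ℝ} (hu : 0 < u) :
    ∃ W : ℝ, 0 ≤ W ∧ ∀ y, u ≤ y → y ≤ v → y ^ c ≤ W := by
  have hc : ContinuousOn (fun y : ℝ => y ^ c) (Icc u v) := fun y hy =>
    (Real.continuousAt_rpow_const y c (Or.inl (by linarith [hy.1]))).continuousWithinAt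
  obtain ⟨M, hM⟩ := isCompact_Icc.exists_bound_of_continuousOn hc
  exact ⟨max M 0, le_max_right _ _, fun y h1 h2 =>
    ((le_abs_self _).trans (hM y ⟨h1, h2⟩)).trans (le_max_left _ _)⟩

/-- The radii beyond which the level sets of `r` are spheres. -/
theorem exists_radius (hΩ : IsScaleInvariantDomain Ω R₀)
    (hx : IsScalingDefiningFunction Ω R₀ x) (hr : IsRadialFunction Ω R₀ r) (ρ : ℝ) :
    ∃ R : ℝ, R₀ < R ∧ (∀ p ∈ Ω, r p = R ↔ ‖p‖ = R) ∧ ∀ p ∈ Ω, ‖p‖ ≤ ρ → r p ≤ R := by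
  obtain ⟨D, hD⟩ := exists_localBounds hΩ hx hr (max ρ R₀)
  -- Since R exceeds the bound D of r on the bounded part, r = R can occur only where r is the norm.
  refine ⟨max D R₀ + 1, by linarith [le_max_right D R₀], fun p hp => ?_, fun p hp hpρ => ?_⟩
  · rcases lt_or_ge ‖p‖ R₀ with h | h
    · have h1 := (hD p hp (h.le.trans (le_max_right _ _))).2.2.2.2.1
      have h2 := le_max_left D R₀
      have h3 := le_max_right D R₀
      constructor <;> intro h' <;> exfalso <;> linarith
    · rw [hr.eq_norm p ⟨hp, by simpa using h⟩]
  · have h1 := (hD p hp (hpρ.trans (le_max_left _ _))).2.2.2.2.1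
    linarith [le_max_left D R₀]

/-- On the support of the cutoff ‖p‖ equals r, so the radial summand r^(b-1) p has size r^b like the
other one. -/
theorem norm_hardyField_le (h0 : 0 ≤ R₀) (hr : IsRadialFunction Ω R₀ r) {p : Euc n} (hp : p ∈ Ω)
    (hx0 : 0 < x p) (hr0 : 0 < r p) {a b s κ B : ℝ} (hB : ‖fderiv ℝ x p‖ ≤ B) :
    ‖hardyField x r (radialCutoff R₀) a b s κ p‖ ≤
      (|s| * B + |κ|) * (x p * (x p ^ a * r p ^ b)) := by
  obtain ⟨χ0, χ1⟩ := radialCutoff_mem (R₀ := R₀) p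
  have hχr : radialCutoff R₀ p * ‖p‖ ≤ r p := by
    by_cases h : radialCutoff R₀ p = 0
    · rw [h, zero_mul]; exact hr0.le
    · have h2 := lt_norm_of_radialCutoff_ne_zero h0 h
      rw [hr.eq_norm p ⟨hp, by rw [mem_ball_zero_iff]; linarith⟩]
      exact mul_le_of_le_one_left (norm_nonneg _) χ1
  have hra := Real.rpow_pos_of_pos hr0 b
  have er : r p ^ (b - 1) * r p = r p ^ b := by
    rw [Real.rpow_sub hr0, Real.rpow_one]; field_simp
  have hrb := Real.rpow_pos_of_pos hr0 (b - 1)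
  have ex : x p ^ (a + 1) = x p * x p ^ a := by rw [Real.rpow_add hx0, Real.rpow_one, mul_comm]
  rw [hardyField, norm_smul, Real.norm_of_nonneg (Real.rpow_nonneg hx0.le _), ex]
  have h1 : ‖(s * r p ^ b) • gradient x p + (κ * radialCutoff R₀ p * r p ^ (b - 1)) • p‖ ≤
      (|s| * B + |κ|) * r p ^ b := by
    refine (norm_add_le _ _).trans ?_
    rw [norm_smul, norm_smul, norm_gradient_eq]
    simp only [norm_mul, Real.norm_eq_abs, abs_of_pos hra, abs_of_pos hrb, abs_of_nonneg χ0]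
    have e1 : |s| * r p ^ b * ‖fderiv ℝ x p‖ ≤ |s| * r p ^ b * B := by gcongr
    have e2 : |κ| * radialCutoff R₀ p * r p ^ (b - 1) * ‖p‖ ≤ |κ| * r p ^ b := by
      rw [← er]
      calc |κ| * radialCutoff R₀ p * r p ^ (b - 1) * ‖p‖
          = |κ| * (r p ^ (b - 1) * (radialCutoff R₀ p * ‖p‖)) := by ring
        _ ≤ |κ| * (r p ^ (b - 1) * r p) := by gcongr
    linarith
  calc x p * x p ^ a * ‖(s * r p ^ b) • gradient x p +
        (κ * radialCutoff R₀ p * r p ^ (b - 1)) • p‖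
      ≤ x p * x p ^ a * ((|s| * B + |κ|) * r p ^ b) := by
        have := Real.rpow_nonneg hx0.le a
        gcongr
    _ = _ := by ring

set_option maxHeartbeats 400000 in
/-- The vector field which yields the weighted Hardy inequality. -/
theorem exists_hardy_field (hΩ : IsScaleInvariantDomain Ω R₀)
    (hx : IsScalingDefiningFunction Ω R₀ x) (hr : IsRadialFunction Ω R₀ r) {a b : ℝ}
    (ha : a + 1 ≠ 0) (hab : a + b + n ≠ 0) :
    ∃ (V : Euc n → Euc n) (c C x₀ R : ℝ), 0 < c ∧ 0 < C ∧ 0 < x₀ ∧ R₀ < R ∧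
      (∀ p ∈ Ω, r p = R ↔ ‖p‖ = R) ∧ ∀ p ∈ Ω, (∀ i, ContDiffAt ℝ 1 (fun q => V q i) p) ∧
        ‖V p‖ ≤ C * (x p * (x p ^ a * r p ^ b)) ∧
        c * (x p ^ a * r p ^ b) ≤ ∑ i, partialD (fun q => V q i) i p +
          {p ∈ Ω | x₀ ≤ x p ∧ r p ≤ R}.indicator (fun _ => C) p := by
  have hR1 := hΩ.one_le
  have hR0 : 0 ≤ R₀ := by linarith
  obtain ⟨B, hB, hbd⟩ := exists_scaledBounds hΩ hx hr
  obtain ⟨δ, hδ, hrδ⟩ := hr.bounded_below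
  set s := (a + 1)⁻¹ with hs
  have hs1 : s * (a + 1) = 1 := inv_mul_cancel₀ ha
  -- Coefficient of θ = x/r needed at infinity: the 1 compensates the loss in |∇x|² ≥ 1/B - θ, the
  -- rest the terms with ⟨∇r, ∇x⟩ and r Δx.
  set K := 1 + |s| * |b| * B ^ 2 + |s| * n * B with hK
  have hK0 : 0 < K := by positivity
  set κ := K / (a + b + n) with hκ
  have hκ1 : κ * (a + b + n) = K := div_mul_cancel₀ _ hab
  obtain ⟨M, hM0, hM⟩ := exists_bound_fderiv_radialCutoff n R₀ (2 * R₀ + 1)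
  obtain ⟨R, hRR, hRiff, hRle⟩ := exists_radius hΩ hx hr (2 * R₀ + 1)
  -- Total error coefficient of θ on the bounded part, with the derivative of the cutoff included.
  -- Then x₀ makes C₄ θ at most 1/(2B) when x < x₀, because r ≥ δ.
  set C₄ := K + |κ| * M with hC₄
  have hC₄0 : 0 < C₄ := by positivity
  set x₀ := δ / (2 * B * C₄) with hx₀
  have hx₀0 : 0 < x₀ := by positivity
  obtain ⟨W₁, hW₁, hxW⟩ := exists_rpow_le a (v := B * R) hx₀0
  obtain ⟨W₂, hW₂, hrW⟩ := exists_rpow_le b (v := R) hδ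
  set C := |s| * B + |κ| + 1 + W₁ * W₂ * (C₄ * B) with hC
  have hC0 : 0 < C := by positivity
  refine ⟨hardyField x r (radialCutoff R₀) a b s κ, 1 / (2 * B), C, x₀, R, by positivity, hC0,
    hx₀0, hRR, hRiff, fun p hp => ?_⟩
  have hx2 : ContDiffAt ℝ 2 x p :=
    (contDiffAt_of_closure hΩ.isOpen hx.smooth hp).of_le (by norm_cast)
  have hr2 : ContDiffAt ℝ 2 r p :=
    (contDiffAt_of_closure hΩ.isOpen hr.smooth hp).of_le (by norm_cast)
  have hχ2 : ContDiffAt ℝ 2 (radialCutoff R₀) p := (contDiff_radialCutoff (N := 2)).contDiffAt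
  have hx0 := hx.pos p hp
  have hrp := hrδ p hp
  have hr0 : 0 < r p := by linarith
  obtain ⟨b1, b2, b3, b4, b5⟩ := hbd p hp
  have hw : 0 < x p ^ a * r p ^ b := mul_pos (Real.rpow_pos_of_pos hx0 _)
    (Real.rpow_pos_of_pos hr0 _)
  obtain ⟨χ0, χ1⟩ := radialCutoff_mem (R₀ := R₀) p
  refine ⟨contDiffAt_hardyField hx2 hr2 hχ2 hx0 hr0, ?_, ?_⟩
  · exact (norm_hardyField_le hR0 hr hp hx0 hr0 b1).trans (by
      gcongr
      rw [hC]
      linarith [show 0 ≤ 1 + W₁ * W₂ * (C₄ * B) by positivity])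
  · rw [div_hardyField hx2 hr2 hχ2 hx0 hr0]
    set w := x p ^ a * r p ^ b with hwdef
    set θ := x p / r p with hθ
    have hθ0 : 0 < θ := by positivity
    have hθB : θ ≤ B := by rw [hθ, div_le_iff₀ hr0]; exact b4
    set X2 := ‖fderiv ℝ x p‖ ^ 2
    set RX := ∑ i, partialD r i p * partialD x i p
    set L := ∑ i, partialD (partialD x i) i p
    set c' := fderiv ℝ (radialCutoff R₀) p p
    set χ := radialCutoff R₀ p
    have hRX : |RX| ≤ B ^ 2 := by
      refine (abs_sum_partialD_mul_le r x p).trans ?_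
      rw [sq]
      gcongr
    have hL : |r p * L| ≤ n * B := by
      rw [abs_mul, abs_of_pos hr0]
      calc r p * |L| ≤ r p * (n * ‖fderiv ℝ (fderiv ℝ x) p‖) := by
            gcongr; exact abs_sum_partialD_partialD_le hx2
        _ = n * (r p * ‖fderiv ℝ (fderiv ℝ x) p‖) := by ring
        _ ≤ n * B := by gcongr
    have hXX : 1 / B - θ ≤ X2 := by
      have : 1 / B ≤ X2 + θ := by rw [div_le_iff₀ hB]; linarith
      linarith
    -- The factor x^(a+1) r^(b-1) of p is homogeneous of degree a + b on the support of χ, and the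
    -- divergence of p itself adds n.
    have hχeuler : χ * ((a + 1) / r p * fderiv ℝ x p p
        + (b - 1) * θ / r p * fderiv ℝ r p p + n * θ) = χ * ((a + b + n) * θ) := by
      by_cases h : χ = 0
      · rw [h, zero_mul, zero_mul]
      · have h2 := lt_norm_of_radialCutoff_ne_zero hR0 h
        rw [hx.euler hΩ hp (by linarith), hr.euler hΩ hp (by linarith), hθ]
        congr 1
        field_simp
        ring
    have hdiv : s * ((a + 1) * X2 + θ * (b * RX + r p * L)) + κ * (θ * c' + χ * ((a + 1) / r p *
        fderiv ℝ x p p + (b - 1) * θ / r p * fderiv ℝ r p p + n * θ)) =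
        X2 + θ * (s * b * RX + s * (r p * L)) + θ * (κ * c') + χ * K * θ := by
      rw [hχeuler]
      calc _ = (s * (a + 1)) * X2 + θ * (s * b * RX + s * (r p * L)) + θ * (κ * c') +
            χ * (κ * (a + b + n)) * θ := by ring
        _ = _ := by rw [hs1, hκ1, one_mul]
    rw [hdiv]
    have hlow : -(K - 1) ≤ s * b * RX + s * (r p * L) := by
      have e1 : |s * b * RX| ≤ |s| * |b| * B ^ 2 := by
        rw [abs_mul, abs_mul]; gcongr
      have e2 : |s * (r p * L)| ≤ |s| * n * B := by
        rw [abs_mul, mul_assoc]; gcongr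
      have := neg_abs_le (s * b * RX)
      have := neg_abs_le (s * (r p * L))
      rw [hK]
      linarith
    have hlow' : θ * (-(K - 1)) ≤ θ * (s * b * RX + s * (r p * L)) := by gcongr
    have hBB : 1 / (2 * B) = 1 / B / 2 := by field_simp
    have hB2 : 0 < 1 / B := by positivity
    have hind : 0 ≤ {p ∈ Ω | x₀ ≤ x p ∧ r p ≤ R}.indicator (fun _ => C) p :=
      indicator_nonneg (fun _ _ => hC0.le) _
    -- Far out χ = 1 and K θ absorbs every error. Nearer, χ K θ ≥ 0 is discarded and either θ is
    -- small or p lies in the set where the constant C compensates.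
    rcases lt_or_ge (2 * R₀ + 1) ‖p‖ with hpR | hpR
    · have hc' : c' = 0 := by
        simp only [c', fderiv_radialCutoff_eq_zero hR0 hpR, zero_apply]
      have hχ : χ = 1 := radialCutoff_eq_one hR0 hpR.le
      rw [hc', hχ]
      have : 1 / (2 * B) ≤ X2 + θ * (s * b * RX + s * (r p * L)) + θ * (κ * 0) + 1 * K * θ := by
        rw [hBB]; linarith
      calc 1 / (2 * B) * w ≤ _ * w := mul_le_mul_of_nonneg_right this hw.le
        _ ≤ _ := by linarith
    · have hcM : θ * (-(|κ| * M)) ≤ θ * (κ * c') := by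
        have e1 : |κ * c'| ≤ |κ| * M := by rw [abs_mul]; gcongr; exact hM p hpR
        have := neg_abs_le (κ * c')
        gcongr
        linarith
      have hχK : 0 ≤ χ * K * θ := by positivity
      have hmain : 1 / B - C₄ * θ ≤
          X2 + θ * (s * b * RX + s * (r p * L)) + θ * (κ * c') + χ * K * θ := by
        rw [hC₄]; linarith
      by_cases hxx : x₀ ≤ x p
      · rw [indicator_of_mem (show p ∈ {p ∈ Ω | x₀ ≤ x p ∧ r p ≤ R} from
          ⟨hp, hxx, hRle p hp hpR⟩)]
        have hwW : w ≤ W₁ * W₂ := by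
          have hrR := hRle p hp hpR
          have e1 := hxW (x p) hxx (b4.trans (by gcongr))
          have e2 := hrW (r p) hrp hrR
          have := Real.rpow_nonneg hr0.le b
          rw [hwdef]
          gcongr
        have hm2 : 1 / (2 * B) - C₄ * B ≤
            X2 + θ * (s * b * RX + s * (r p * L)) + θ * (κ * c') + χ * K * θ := by
          have : C₄ * θ ≤ C₄ * B := by gcongr
          rw [hBB]; linarith
        have e3 : w * (C₄ * B) ≤ C := by
          have : w * (C₄ * B) ≤ W₁ * W₂ * (C₄ * B) := by gcongr
          have : 0 ≤ |s| * B + |κ| + 1 := by positivity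
          rw [hC]; linarith
        have e4 := mul_le_mul_of_nonneg_left hm2 hw.le
        rw [mul_sub] at e4
        linarith
      · have hθs : C₄ * θ ≤ 1 / B / 2 := by
          have e1 : θ ≤ x₀ / δ := by
            rw [hθ]
            exact div_le_div₀ hx₀0.le (not_le.1 hxx).le hδ hrp
          calc C₄ * θ ≤ C₄ * (x₀ / δ) := by gcongr
            _ = _ := by rw [hx₀]; field_simp
        have : 1 / (2 * B) ≤
            X2 + θ * (s * b * RX + s * (r p * L)) + θ * (κ * c') + χ * K * θ := by
          rw [hBB]; linarith
        calc 1 / (2 * B) * w ≤ _ * w := mul_le_mul_of_nonneg_right this hw.le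
          _ ≤ _ := by linarith

end HardyEstimate

/-! ### Integration by parts and the pointwise inequality. -/

section Integration

open Matrix

variable {n k l : ℕ} {Ω K : Set (Euc n)}

theorem eventuallyEq_zero_of_notMem {f : Euc n → ℝ} (hK : IsCompact K)
    (h0 : ∀ p ∉ K, f p = 0) {p : Euc n} (hp : p ∉ K) : f =ᶠ[𝓝 p] fun _ => 0 := by
  filter_upwards [hK.isClosed.isOpen_compl.mem_nhds hp] with q hq using h0 q hq

theorem integrable_of_continuousAt {f : Euc n → ℝ} (hK : IsCompact K) (hKΩ : K ⊆ Ω)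
    (hf : ∀ p ∈ Ω, ContinuousAt f p) (h0 : ∀ p ∉ K, f p = 0) : Integrable f := by
  have hc : Continuous f := by
    rw [continuous_iff_continuousAt]
    intro p
    by_cases hp : p ∈ K
    · exact hf p (hKΩ hp)
    · exact continuousAt_const.congr (eventuallyEq_zero_of_notMem hK h0 hp).symm
  exact hc.integrable_of_hasCompactSupport (HasCompactSupport.intro hK h0)

theorem contDiff_of_contDiffAt {f : Euc n → ℝ} (hK : IsCompact K) (hKΩ : K ⊆ Ω)
    (hf : ∀ p ∈ Ω, ContDiffAt ℝ 1 f p) (h0 : ∀ p ∉ K, f p = 0) : ContDiff ℝ 1 f := by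
  rw [contDiff_iff_contDiffAt]
  intro p
  by_cases hp : p ∈ K
  · exact hf p (hKΩ hp)
  · exact contDiffAt_const.congr_of_eventuallyEq (eventuallyEq_zero_of_notMem hK h0 hp)

theorem integral_partialD_eq_zero {f : Euc n → ℝ} (hf : ContDiff ℝ 1 f)
    (hc : HasCompactSupport f) (i : Fin n) :
    Integrable (partialD f i) ∧ ∫ p, partialD f i p = 0 := by
  have hcont : Continuous (partialD f i) :=
    (hf.continuous_fderiv (by simp)).clm_apply continuous_const
  have hint : Integrable (partialD f i) := by
    refine hcont.integrable_of_hasCompactSupport ?_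
    exact (hc.fderiv (𝕜 := ℝ)).comp_left (g := fun L : Euc n →L[ℝ] ℝ =>
      L (EuclideanSpace.single i 1)) rfl
  refine ⟨hint, ?_⟩
  -- Integration by parts against the constant function one.
  have h := integral_mul_fderiv_eq_neg_fderiv_mul_of_integrable (μ := volume)
    (f := fun _ : Euc n => (1 : ℝ)) (g := f) (v := EuclideanSpace.single i 1)
    (by simp) (by simpa [partialD] using! hint)
    (by simpa using hf.continuous.integrable_of_hasCompactSupport hc)
    (fun _ _ => differentiableAt_const _) (fun p _ => (hf.differentiable (by simp)) p)
  simpa [partialD] using h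

theorem normSq_zero (G : Matrix (Fin n) (Fin n) ℝ) : normSq G (0 : TensorComp n k l) = 0 := by
  simp [normSq]

theorem covDeriv_eq_zero {g : Euc n → Matrix (Fin n) (Fin n) ℝ} {u : Euc n → TensorComp n k l}
    {p : Euc n} (hp : p ∉ tsupport u) : covDeriv g u p = 0 := by
  have h := notMem_tsupport_iff_eventuallyEq.1 hp
  have h1 : ∀ I J a, partialD (fun q => u q I J) a p = 0 := by
    intro I J a
    have : (fun q => u q I J) =ᶠ[𝓝 p] fun _ => (0 : ℝ) := h.mono fun q hq => by simp [hq]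
    unfold partialD
    rw [this.fderiv_eq (𝕜 := ℝ)]
    simp
  ext I J
  simp [covDeriv, h1, h.self_of_nhds]

theorem sphereInt_nonneg {g : Euc n → Matrix (Fin n) (Fin n) ℝ} {R : ℝ} (hR : 0 ≤ R)
    {A : Set (Euc n)} {f : Euc n → ℝ} (hf : ∀ p ∈ A, 0 ≤ f p) : 0 ≤ sphereInt g R A f := by
  unfold sphereInt
  refine mul_nonneg (pow_nonneg hR _) (integral_nonneg fun ν => ?_)
  exact indicator_nonneg (fun p hp => mul_nonneg (hf p hp) (Real.sqrt_nonneg _)) _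

theorem volInt_nonneg {g : Euc n → Matrix (Fin n) (Fin n) ℝ} {A : Set (Euc n)}
    (hA : MeasurableSet A) {f : Euc n → ℝ} (hf : ∀ p ∈ A, 0 ≤ f p) : 0 ≤ volInt g A f :=
  setIntegral_nonneg hA fun p hp => mul_nonneg (hf p hp) (Real.sqrt_nonneg _)

theorem measurableSet_sublevel {x r : Euc n → ℝ} (hΩ : IsOpen Ω) (hx : ContinuousOn x Ω)
    (hr : ContinuousOn r Ω) (x₀ R : ℝ) : MeasurableSet {p ∈ Ω | x₀ ≤ x p ∧ r p ≤ R} := by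
  have h1 := hx.isOpen_inter_preimage hΩ (isOpen_Iio (a := x₀))
  have h2 := hr.isOpen_inter_preimage hΩ (isOpen_Ioi (a := R))
  have : {p ∈ Ω | x₀ ≤ x p ∧ r p ≤ R} = Ω \ (Ω ∩ x ⁻¹' Iio x₀ ∪ Ω ∩ r ⁻¹' Ioi R) := by
    ext p
    simp only [mem_ofPred_eq, Set.mem_sdiff, mem_union, mem_inter_iff, mem_preimage, mem_Iio, mem_Ioi]
    constructor
    · rintro ⟨h, h1, h2⟩
      refine ⟨h, ?_⟩
      rintro (⟨-, h'⟩ | ⟨-, h'⟩) <;> linarith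
    · rintro ⟨h, h'⟩
      push Not at h'
      exact ⟨h, h'.1 h, h'.2 h⟩
  rw [this]
  exact hΩ.measurableSet.diff (h1.union h2).measurableSet

/-- Young's inequality in the form 4PQ ≤ (P + Q)². -/
theorem abs_le_add_of_sq_le {z P Q : ℝ} (hP : 0 ≤ P) (hQ : 0 ≤ Q) (h : z ^ 2 ≤ 4 * P * Q) :
    |z| ≤ P + Q :=
  abs_le_of_sq_le_sq (by nlinarith [sq_nonneg (P - Q)]) (by positivity)

/-- The pointwise form of the weighted Hardy inequality, for a tensor field and a vector field. -/
theorem hardy_pointwise {g : Euc n → Matrix (Fin n) (Fin n) ℝ} {p : Euc n}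
    (hg : ∀ i j, ContDiffAt ℝ 1 (fun q => g q i j) p) (hpos : ∀ᶠ q in 𝓝 p, (g q).PosDef)
    {u : Euc n → TensorComp n k l} (hu : ∀ I J, ContDiffAt ℝ 1 (fun q => u q I J) p)
    {V : Euc n → Euc n} (hV : ∀ i, ContDiffAt ℝ 1 (fun q => V q i) p)
    {c C M X w ι : ℝ} (hc : 0 < c) (hM : 0 < M) (hw : 0 ≤ w)
    (hgM : ∀ v : Euc n, ⇑v ⬝ᵥ g p *ᵥ ⇑v ≤ M * ‖v‖ ^ 2) (hVn : ‖V p‖ ≤ C * (X * w))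
    (hdiv : c * w ≤ ∑ i, partialD (fun q => V q i) i p + ι) :
    c / 2 * (w * normSq (g p) (u p)) ≤
      ∑ i, partialD (fun q => normSq (g q) (u q) * V q i) i p + ι * normSq (g p) (u p)
        + 2 * M * C ^ 2 / c * (X ^ 2 * w * normSq (g p) (covDeriv g u p)) := by
  have hp := hpos.self_of_nhds
  set F := fun q => normSq (g q) (u q) with hF
  set E := normSq (g p) (covDeriv g u p) with hE
  have hF0 : 0 ≤ F p := normSq_nonneg hp _
  have hE0 : 0 ≤ E := normSq_nonneg hp _
  have hFd : DifferentiableAt ℝ F p :=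
    (contDiffAt_normSq hg hp.det_pos.ne' hu).differentiableAt (by simp)
  have hsum : ∑ i, partialD (fun q => F q * V q i) i p =
      F p * ∑ i, partialD (fun q => V q i) i p + fderiv ℝ F p (V p) := by
    rw [fderiv_eq_sum_partialD, Finset.mul_sum, ← Finset.sum_add_distrib]
    refine Finset.sum_congr rfl fun i _ => ?_
    unfold partialD
    rw [fderiv_fun_mul hFd ((hV i).differentiableAt (by simp))]
    simp
  -- The first factor is half of the term c w F supplied by the divergence, so it can be absorbed;
  -- the second is then forced by the product.
  have hsq : (fderiv ℝ F p (V p)) ^ 2 ≤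
      4 * (c / 2 * (w * F p)) * (2 * M * C ^ 2 / c * (X ^ 2 * w * E)) := by
    refine (sq_fderiv_normSq_le hg hpos hu (V p)).trans ?_
    have h1 : ⇑(V p) ⬝ᵥ g p *ᵥ ⇑(V p) ≤ M * (C * (X * w)) ^ 2 :=
      (hgM _).trans (by gcongr)
    calc 4 * (⇑(V p) ⬝ᵥ g p *ᵥ ⇑(V p)) * F p * E ≤ 4 * (M * (C * (X * w)) ^ 2) * F p * E := by
          gcongr
      _ = _ := by field_simp
  have habs := abs_le_add_of_sq_le (by positivity) (by positivity) hsq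
  have h2 := neg_abs_le (fderiv ℝ F p (V p))
  have h3 := mul_le_mul_of_nonneg_right hdiv hF0
  rw [hsum]
  have h4 : c / 2 * (w * F p) + c / 2 * (w * F p) = c * w * F p := by ring
  change c / 2 * (w * F p) ≤ _ + ι * F p + _
  linarith

end Integration
end WeightedPoincare

/-! ### Assembly of the weighted inequality. -/

open WeightedPoincare in
theorem mainTheorem6 (n : ℕ) (Ω : Set (WeightedPoincare.Euc n)) (R₀ : ℝ)
    (hΩ : WeightedPoincare.IsScaleInvariantDomain Ω R₀)
    (x : WeightedPoincare.Euc n → ℝ)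
    (hx : WeightedPoincare.IsScalingDefiningFunction Ω R₀ x)
    (r : WeightedPoincare.Euc n → ℝ)
    (hr : WeightedPoincare.IsRadialFunction Ω R₀ r)
    (g : WeightedPoincare.Euc n → Matrix (Fin n) (Fin n) ℝ)
    (hg : WeightedPoincare.IsAsymptoticallyEuclideanMetric Ω g)
    (σ μ : ℝ) (hσ : σ ≠ -1 / 2) (hσμ : σ + μ + (n : ℝ) / 2 ≠ 0) :
    ∃ x₀ C R : ℝ, 0 < x₀ ∧ 0 < C ∧ R₀ < R ∧
      -- the level set of `r` in the boundary term is the coordinate sphere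
      (∀ p ∈ Ω, r p = R ↔ ‖p‖ = R) ∧
      ∀ (k l : ℕ) (u : WeightedPoincare.Euc n → WeightedPoincare.TensorComp n k l),
        ContDiff ℝ 2 u → HasCompactSupport u → tsupport u ⊆ Ω →
        WeightedPoincare.volInt g Ω
            (fun p => x p ^ (2 * σ) * r p ^ (2 * μ) * WeightedPoincare.normSq (g p) (u p)) ≤
          C * (WeightedPoincare.sphereInt g R {p ∈ Ω | x₀ ≤ x p ∧ r p = R}
                (fun p => WeightedPoincare.normSq (g p) (u p))
            + WeightedPoincare.volInt g {p ∈ Ω | x₀ ≤ x p ∧ r p ≤ R}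
                (fun p => WeightedPoincare.normSq (g p) (u p))
            + WeightedPoincare.volInt g Ω
                (fun p => x p ^ (2 * σ + 2) * r p ^ (2 * μ) *
                  WeightedPoincare.normSq (g p) (WeightedPoincare.covDeriv g u p))) := by
  obtain ⟨V, c, C, x₀, R, hc, hC, hx₀, hR, hRiff, hV⟩ := exists_hardy_field hΩ hx hr
    (a := 2 * σ) (b := 2 * μ) (fun h => hσ (by linarith)) (fun h => hσμ (by linarith))
  obtain ⟨m, M, hm, hM, hgb⟩ := hg.exists_bounds
  obtain ⟨δ, hδ, hrδ⟩ := hr.bounded_below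
  set Q := 2 * M * C ^ 2 / c with hQ
  have hQ0 : 0 < Q := by positivity
  -- M and 1/m pass between Lebesgue and Riemannian measure, 2/c undoes the factor c/2 of the
  -- pointwise bound, and C + Q dominates both coefficients. Nothing depends on the type of u.
  refine ⟨x₀, 2 * M / c / m * (C + Q), R, hx₀, by positivity, hR, hRiff, ?_⟩
  intro k l u hu hcs hsupp
  have hR0 : 0 ≤ R := by linarith [hΩ.one_le]
  set K := tsupport u with hKdef
  have hK : IsCompact K := hcs
  set A := {p ∈ Ω | x₀ ≤ x p ∧ r p ≤ R} with hA
  have hxc : ∀ p ∈ Ω, ContinuousAt x p := fun p hp =>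
    (contDiffAt_of_closure hΩ.isOpen hx.smooth hp).continuousAt
  have hrc : ∀ p ∈ Ω, ContinuousAt r p := fun p hp =>
    (contDiffAt_of_closure hΩ.isOpen hr.smooth hp).continuousAt
  have hAm : MeasurableSet A := measurableSet_sublevel hΩ.isOpen
    (fun p hp => (hxc p hp).continuousWithinAt) (fun p hp => (hrc p hp).continuousWithinAt) x₀ R
  have hg1 : ∀ p ∈ Ω, ∀ i j, ContDiffAt ℝ 1 (fun q => g q i j) p := fun p hp i j =>
    (hg.contDiffOn i j).contDiffAt (hΩ.isOpen.mem_nhds hp)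
  have hgp : ∀ p ∈ Ω, (g p).PosDef := fun p hp => hg.posDef p (subset_closure hp)
  have hgpe : ∀ p ∈ Ω, ∀ᶠ q in 𝓝 p, (g q).PosDef := fun p hp =>
    Filter.mem_of_superset (hΩ.isOpen.mem_nhds hp) hgp
  have hu1 : ∀ p I J, ContDiffAt ℝ 1 (fun q => u q I J) p := fun p I J =>
    ((contDiff_pi.1 (contDiff_pi.1 hu I) J).of_le (by norm_num)).contDiffAt
  have hF0 : ∀ p ∉ K, normSq (g p) (u p) = 0 := fun p hp => by
    rw [image_eq_zero_of_notMem_tsupport hp, normSq_zero]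
  have hE0 : ∀ p ∉ K, normSq (g p) (covDeriv g u p) = 0 := fun p hp => by
    rw [covDeriv_eq_zero hp, normSq_zero]
  have hFc : ∀ p ∈ Ω, ContDiffAt ℝ 1 (fun q => normSq (g q) (u q)) p := fun p hp =>
    contDiffAt_normSq (hg1 p hp) (hgp p hp).det_pos.ne' (hu1 p)
  have hEc : ∀ p ∈ Ω, ContinuousAt (fun q => normSq (g q) (covDeriv g u q)) p := fun p hp =>
    continuousAt_normSq_covDeriv (hg1 p hp) (hgp p hp).det_pos.ne' (hu1 p)
  have hdc : ∀ p ∈ Ω, ContinuousAt (fun q => √(g q).det) p := fun p hp =>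
    (contDiffAt_det (hg1 p hp)).continuousAt.sqrt
  have hr0 : ∀ p ∈ Ω, 0 < r p := fun p hp => hδ.trans_le (hrδ p hp)
  have hwc : ∀ t : ℝ, ∀ p ∈ Ω, ContinuousAt (fun q => x q ^ t * r q ^ (2 * μ)) p :=
    fun t p hp => ((hxc p hp).rpow_const (Or.inl (hx.pos p hp).ne')).mul
      ((hrc p hp).rpow_const (Or.inl (hr0 p hp).ne'))
  have hi1 : Integrable fun p => x p ^ (2 * σ) * r p ^ (2 * μ) * normSq (g p) (u p) *
      √(g p).det := integrable_of_continuousAt hK hsupp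
    (fun p hp => ((hwc _ p hp).mul (hFc p hp).continuousAt).mul (hdc p hp))
    (fun p hp => by simp [hF0 p hp])
  have hi2 : Integrable fun p => normSq (g p) (u p) * √(g p).det :=
    integrable_of_continuousAt hK hsupp (fun p hp => (hFc p hp).continuousAt.mul (hdc p hp))
      (fun p hp => by simp [hF0 p hp])
  have hi3 : Integrable fun p => x p ^ (2 * σ + 2) * r p ^ (2 * μ) *
      normSq (g p) (covDeriv g u p) * √(g p).det := integrable_of_continuousAt hK hsupp
    (fun p hp => ((hwc _ p hp).mul (hEc p hp)).mul (hdc p hp)) (fun p hp => by simp [hE0 p hp])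
  have hGi : ∀ i, Integrable (partialD (fun q => normSq (g q) (u q) * V q i) i) ∧
      ∫ p, partialD (fun q => normSq (g q) (u q) * V q i) i p = 0 := fun i =>
    integral_partialD_eq_zero (contDiff_of_contDiffAt hK hsupp
      (fun p hp => (hFc p hp).mul ((hV p hp).1 i)) (fun p hp => by simp [hF0 p hp]))
      (HasCompactSupport.intro hK fun p hp => by simp [hF0 p hp]) i
  set D := fun p => ∑ i, partialD (fun q => normSq (g q) (u q) * V q i) i p with hD
  have hDi : Integrable D := integrable_finsetSum _ fun i _ => (hGi i).1
  have hD0 : ∫ p in Ω, D p = 0 := by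
    rw [setIntegral_eq_integral_of_forall_compl_eq_zero]
    · rw [hD, integral_finsetSum _ fun i _ => (hGi i).1]
      exact Finset.sum_eq_zero fun i _ => (hGi i).2
    · intro p hp
      refine Finset.sum_eq_zero fun i _ => ?_
      have : (fun q => normSq (g q) (u q) * V q i) =ᶠ[𝓝 p] fun _ => 0 :=
        eventuallyEq_zero_of_notMem hK (fun q hq => by simp [hF0 q hq]) fun h => hp (hsupp h)
      rw [partialD, this.fderiv_eq (𝕜 := ℝ)]
      simp
  have hpt : ∀ p ∈ Ω, x p ^ (2 * σ) * r p ^ (2 * μ) * normSq (g p) (u p) * √(g p).det ≤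
      2 * M / c * D p + 2 * M / c / m *
        (C * A.indicator (fun p => normSq (g p) (u p) * √(g p).det) p
        + Q * (x p ^ (2 * σ + 2) * r p ^ (2 * μ) *
          normSq (g p) (covDeriv g u p) * √(g p).det)) := by
    intro p hp
    obtain ⟨hV1, hV2, hV3⟩ := hV p hp
    obtain ⟨hm1, hM1, hgM⟩ := hgb p hp
    have hx0 := hx.pos p hp
    have hw : 0 ≤ x p ^ (2 * σ) * r p ^ (2 * μ) :=
      mul_nonneg (Real.rpow_nonneg hx0.le _) (Real.rpow_nonneg (hr0 p hp).le _)
    have h := hardy_pointwise (hg1 p hp) (hgpe p hp) (hu1 p) hV1 hc hM hw hgM hV2 hV3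
    have hex : x p ^ (2 * σ + 2) * r p ^ (2 * μ) =
        x p ^ 2 * (x p ^ (2 * σ) * r p ^ (2 * μ)) := by
      rw [Real.rpow_add hx0, Real.rpow_two]; ring
    rw [hex]
    have hF : 0 ≤ normSq (g p) (u p) := normSq_nonneg (hgp p hp) _
    have hE : 0 ≤ normSq (g p) (covDeriv g u p) := normSq_nonneg (hgp p hp) _
    have hind : A.indicator (fun _ => C) p * normSq (g p) (u p) * m ≤
        C * A.indicator (fun p => normSq (g p) (u p) * √(g p).det) p := by
      by_cases hpA : p ∈ A
      · rw [indicator_of_mem hpA, indicator_of_mem hpA, mul_assoc]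
        gcongr
      · simp [indicator_of_notMem hpA]
    set w := x p ^ (2 * σ) * r p ^ (2 * μ)
    set F := normSq (g p) (u p)
    set E := normSq (g p) (covDeriv g u p)
    have hEm : Q * (x p ^ 2 * w * E) * m ≤ Q * (x p ^ 2 * w * E * √(g p).det) := by
      rw [mul_assoc]
      gcongr
    -- The density is removed before the pointwise bound is applied and restored only on the
    -- nonnegative terms, so D p stays free of it and integrates to zero.
    calc w * F * √(g p).det ≤ w * F * M := by gcongr
      _ = 2 * M / c * (c / 2 * (w * F)) := by field_simp
      _ ≤ 2 * M / c * (D p + A.indicator (fun _ => C) p * F + Q * (x p ^ 2 * w * E)) := by gcongr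
      _ = 2 * M / c * D p + 2 * M / c / m *
          (A.indicator (fun _ => C) p * F * m + Q * (x p ^ 2 * w * E) * m) := by
        field_simp
        ring
      _ ≤ _ := by gcongr
  have hint : volInt g Ω (fun p => x p ^ (2 * σ) * r p ^ (2 * μ) * normSq (g p) (u p)) ≤
      2 * M / c / m * (C * volInt g A (fun p => normSq (g p) (u p))
        + Q * volInt g Ω (fun p => x p ^ (2 * σ + 2) * r p ^ (2 * μ) *
          normSq (g p) (covDeriv g u p))) := by
    have hi2' := (hi2.indicator hAm).const_mul C
    have hi3' := hi3.const_mul Q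
    have hi4 := (hi2'.fun_add hi3').const_mul (2 * M / c / m)
    have h := setIntegral_mono_on hi1.integrableOn
      ((hDi.const_mul (2 * M / c)).fun_add hi4).integrableOn hΩ.isOpen.measurableSet hpt
    refine h.trans_eq ?_
    rw [integral_add (hDi.const_mul _).integrableOn hi4.integrableOn, integral_const_mul, hD0,
      mul_zero, zero_add, integral_const_mul, integral_add hi2'.integrableOn hi3'.integrableOn,
      integral_const_mul, integral_const_mul,
      setIntegral_indicator hAm, inter_eq_self_of_subset_right (fun p hp => hp.1)]
    rfl
  refine hint.trans ?_
  -- The estimate already holds with the volume terms alone; nonnegativity allows the sphere term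
  -- and the common constant.
  have hS := sphereInt_nonneg (g := g) hR0 (A := {p ∈ Ω | x₀ ≤ x p ∧ r p = R})
    (f := fun p => normSq (g p) (u p)) (fun p hp => normSq_nonneg (hgp p hp.1) _)
  have hI := volInt_nonneg (g := g) hAm
    (f := fun p => normSq (g p) (u p)) (fun p hp => normSq_nonneg (hgp p hp.1) _)
  have hJ := volInt_nonneg (g := g) hΩ.isOpen.measurableSet
    (f := fun p => x p ^ (2 * σ + 2) * r p ^ (2 * μ) * normSq (g p) (covDeriv g u p))
    (fun p hp => mul_nonneg (mul_nonneg (Real.rpow_nonneg (hx.pos p hp).le _)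
      (Real.rpow_nonneg (hr0 p hp).le _)) (normSq_nonneg (hgp p hp) _))
  rw [mul_assoc]
  gcongr
  nlinarith
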